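/- Let $\mathbb{K}$ be a field, $n\ge 0$, $m_1,\dots,m_n\in\mathbb{Z}$, and $\mathbf{k}_n=\bigoplus_{i=1}^n\mathbb{K}e_i$ with orthogonal idempotents $e_i$. Let $\mathbf{k}$ be a $\mathbb{K}$-algebra and $\varphi:\mathbf{k}_n\to\mathbf{k}$ a $\mathbb{K}$-linear map that is multiplicative on each summand $\mathbb{K}e_i$, i.e. $\varepsilon_i:=\varphi(e_i)$ is an idempotent for every $i$ (for instance, any homomorphism of $\mathbb{K}$-algebras, or the map $\mathbf{k}_n\to\bigoplus_v\mathbb{K}e_v$, $e_i\mapsto e_{v(i)}$, given by a map of index sets $i\mapsto v(i)$, in particular $\mathbf{k}_n\to\mathbb{K}$, $e_i\mapsto 1$). Products are read from right to left. Let $\mathscr{I}_n^{\mathbf{k}}$ be the DG-algebra over $\mathbb{K}$ whose underlying algebra is freely generated over $\mathbf{k}$ (placed in degree $0$, with $\mathbb{K}$ central) by symbols $c^0_{ij}$ ($1\le i<j\le n$) and $c^p_{ij}$ ($p\ge1$, $1\le i,j\le n$), subject only to $\varepsilon_jc^p_{ij}=c^p_{ij}=c^p_{ij}\varepsilon_i$,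 with grading $|c^p_{ij}|=1-2p+m_j-m_i$ and with differential of degree $1$ determined by $\partial|_{\mathbf{k}}=0$, the rule $\partial(a_2a_1)=\partial(a_2)a_1+(-1)^{|a_2|}a_2\,\partial(a_1)$, and $$\partial c^p_{ij}=\delta_{1p}\,\delta_{ij}\,\varepsilon_i+\sum_{q=0}^{p}\sum_{r=1}^n(-1)^{m_r+m_j}\,c^{p-q}_{rj}\,c^{q}_{ir},\qquad c^0_{ij}:=0\text{ for }i\ge j .$$ Let $\mathscr{A}_n^{\mathbf{k}}\subset\mathscr{I}_n^{\mathbf{k}}$ be the DG-subalgebra generated over $\mathbf{k}$ by the $c^0_{ij}$ and the $c^1_{ij}$. **Lemma.** For every such $\varphi$ there is a morphism of DG-algebras $\mathfrak{r}:\mathscr{I}_n^{\mathbf{k}}\to\mathscr{A}_n^{\mathbf{k}}$ with $\mathfrak{r}|_{\mathscr{A}_n^{\mathbf{k}}}=\mathrm{id}$ and, for $p>1$, $$\mathfrak{r}(c^p_{ij})=C_{p-1}\sum_{k_1,\dots,k_{2p-2}=1}^n(-1)^{m_{k_1}+\dots+m_{k_{2p-2}}}\;c^1_{k_{2p-2}j}\cdots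 c^1_{k_1k_2}\,c^1_{ik_1},\qquad C_p=\frac1{p+1}\binom{2p}{p},$$ and $\mathfrak{r}$ is a quasi-isomorphism. Moreover, for $n=2$, $\mathbf{k}=\mathbb{K}$, $e_1,e_2\mapsto1$, there is a quasi-isomorphism of DG-algebras $\mathscr{I}_2^{\mathbb{K}}\to\mathbb{K}[z,z^{-1}]$ with $c^0_{12}\mapsto z$, where $\mathbb{K}[z,z^{-1}]$ has zero differential and $|z|=1+m_2-m_1$. -/

import Mathlib

open scoped DirectSum

universe u v w w'

noncomputable section

/-! ## Differential graded algebras -/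

/-- A (cohomologically graded) DG-algebra over `K`: a `ℤ`-graded `K`-algebra with a differential of
degree `1` satisfying `∂ (x y) = (∂ x) y + (-1) ^ |x| x (∂ y)`. -/
structure DGAlgebra (K : Type u) [Field K] where
  carrier : Type w
  [ring : Ring carrier]
  [algebra : Algebra K carrier]
  grading : ℤ → Submodule K carrier
  gradedMonoid : SetLike.GradedMonoid grading
  isInternal : DirectSum.IsInternal grading
  d : carrier →ₗ[K] carrier
  d_mem : ∀ (i : ℤ) (x : carrier), x ∈ grading i → d x ∈ grading (i + 1)
  d_d : ∀ x : carrier, d (d x) = 0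
  leibniz : ∀ (i : ℤ) (x y : carrier), x ∈ grading i →
    d (x * y) = d x * y + i.negOnePow • (x * d y)

namespace DGAlgebra

variable {K : Type u} [Field K]

instance (D : DGAlgebra.{u, w} K) : Ring D.carrier := D.ring

instance (D : DGAlgebra.{u, w} K) : Algebra K D.carrier := D.algebra

/-- The differential `D^i → D^{i+1}`. -/
def dRestrict (D : DGAlgebra.{u, w} K) (i : ℤ) : D.grading i →ₗ[K] D.grading (i + 1) :=
  D.d.restrict (fun x hx => D.d_mem i x hx)

/-- The cochain complex of `K`-vector spaces underlying a DG-algebra. -/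
def complex (D : DGAlgebra.{u, w} K) : CochainComplex (ModuleCat.{w} K) ℤ :=
  CochainComplex.of (fun i => ModuleCat.of K (D.grading i))
    (fun i => ModuleCat.ofHom (D.dRestrict i))
    (fun i => by
      ext x
      exact D.d_d x)

theorem complex_d (D : DGAlgebra.{u, w} K) (i : ℤ) :
    D.complex.d i (i + 1) = ModuleCat.ofHom (D.dRestrict i) :=
  CochainComplex.of_d (fun i => ModuleCat.of K (D.grading i))
    (fun i => ModuleCat.ofHom (D.dRestrict i)) i

/-- A morphism of DG-algebras: a unital algebra map of degree `0` commuting with differentials. -/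
structure Hom (D : DGAlgebra.{u, w} K) (E : DGAlgebra.{u, w'} K) where
  toAlgHom : D.carrier →ₐ[K] E.carrier
  map_mem : ∀ (i : ℤ) (x : D.carrier), x ∈ D.grading i → toAlgHom x ∈ E.grading i
  comm : ∀ x : D.carrier, toAlgHom (D.d x) = E.d (toAlgHom x)

instance (D : DGAlgebra.{u, w} K) (E : DGAlgebra.{u, w'} K) :
    CoeFun (Hom D E) (fun _ => D.carrier → E.carrier) := ⟨fun f => f.toAlgHom⟩

/-- The degree `i` component of a morphism. -/
def Hom.restrict {D : DGAlgebra.{u, w} K} {E : DGAlgebra.{u, w'} K} (f : Hom D E) (i : ℤ) :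
    D.grading i →ₗ[K] E.grading i :=
  f.toAlgHom.toLinearMap.restrict (fun x hx => f.map_mem i x hx)

/-- The map of cochain complexes underlying a morphism of DG-algebras. -/
def Hom.chainMap {D E : DGAlgebra.{u, w} K} (f : Hom D E) : D.complex ⟶ E.complex :=
  CochainComplex.ofHom (fun i => ModuleCat.ofHom (f.restrict i))
    (fun i => by
      rw [complex_d, complex_d]
      ext x
      exact Subtype.ext (f.comm (Subtype.val (p := fun y => y ∈ D.grading i) x)).symm)

/-- A morphism of DG-algebras is a quasi-isomorphism if it induces isomorphisms on cohomology. -/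
def Hom.IsQuasiIso {D E : DGAlgebra.{u, w} K} (f : Hom D E) : Prop :=
  QuasiIso f.chainMap

/-- The DG-subalgebra of `D` on a graded subalgebra `S` which is preserved by the differential. -/
def sub (D : DGAlgebra.{u, w} K) (S : Subalgebra K D.carrier)
    (hd : ∀ x ∈ S, D.d x ∈ S)
    (hS : ∀ x ∈ S, x ∈ ⨆ i, Subalgebra.toSubmodule S ⊓ D.grading i) : DGAlgebra.{u, w} K where
  carrier := S
  grading i := (D.grading i).comap S.val.toLinearMap
  gradedMonoid :=
    { one_mem := D.gradedMonoid.one_mem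
      mul_mem := fun _ _ _ _ hx hy => D.gradedMonoid.mul_mem hx hy }
  isInternal := by
    rw [DirectSum.isInternal_submodule_iff_iSupIndep_and_iSup_eq_top]
    have h := D.isInternal
    rw [DirectSum.isInternal_submodule_iff_iSupIndep_and_iSup_eq_top] at h
    constructor
    · have h1 := h.1
      rw [iSupIndep_def] at h1 ⊢
      intro i
      rw [Submodule.disjoint_def]
      intro x hx hx'
      have := (Submodule.disjoint_def.1 (h1 i)) (x : D.carrier) hx (by
        have h2 : S.val.toLinearMap x ∈ Submodule.map S.val.toLinearMap
          (⨆ j, ⨆ (_ : j ≠ i), (D.grading j).comap S.val.toLinearMap) :=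
          Submodule.mem_map_of_mem hx'
        simp only [Submodule.map_iSup] at h2
        have h3 : (⨆ j, ⨆ (_ : j ≠ i), Submodule.map S.val.toLinearMap
            ((D.grading j).comap S.val.toLinearMap)) ≤ ⨆ j, ⨆ (_ : j ≠ i), D.grading j :=
          iSup_mono fun j => iSup_mono fun _ => Submodule.map_comap_le _ _
        exact h3 h2)
      exact Subtype.ext this
    · rw [eq_top_iff]
      rintro ⟨x, hx⟩ -
      have h2 := hS x hx
      have h3 : (⨆ i, Subalgebra.toSubmodule S ⊓ D.grading i) ≤
          Submodule.map S.val.toLinearMap (⨆ i, (D.grading i).comap S.val.toLinearMap) := by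
        rw [Submodule.map_iSup]
        refine iSup_mono fun i => ?_
        rintro y ⟨hy, hy'⟩
        exact ⟨⟨y, hy⟩, hy', rfl⟩
      obtain ⟨y, hy, hyx⟩ := h3 h2
      have : y = ⟨x, hx⟩ := Subtype.ext hyx
      exact this ▸ hy
  d := D.d.restrict (p := Subalgebra.toSubmodule S) (q := Subalgebra.toSubmodule S) hd
  d_mem i x hx := D.d_mem i x hx
  d_d x := Subtype.ext (D.d_d x)
  leibniz i x y hx := Subtype.ext (D.leibniz i x y hx)

/-- The Laurent polynomial algebra `K[z, z⁻¹]` with `z` in degree `e` and zero differential; the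
degree `i` part is spanned by the monomials `z ^ a` with `a * e = i`. -/
def laurent (K : Type u) [Field K] (e : ℤ) : DGAlgebra.{u, u} K where
  carrier := LaurentPolynomial K
  grading i := AddMonoidAlgebra.gradeBy K (AddMonoidHom.mulRight e) i
  gradedMonoid := AddMonoidAlgebra.gradeBy.gradedMonoid (AddMonoidHom.mulRight e)
  isInternal := DirectSum.Decomposition.isInternal
    (AddMonoidAlgebra.gradeBy K (AddMonoidHom.mulRight e))
  d := 0
  d_mem i x _ := Submodule.zero_mem _
  d_d x := rfl
  leibniz i x y _ := by simp

end DGAlgebra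

/-! ## The internal DG-algebras -/

/-- A coefficient map from `k_n = K e_1 ⊕ ⋯ ⊕ K e_n` to a `K`-algebra `k`: a `K`-linear map which is
multiplicative on each summand `K e_i`, that is, sends each `e_i` to an idempotent. The images of
distinct `e_i` are not required to be orthogonal (nor distinct), so that `e_i ↦ e_{v(i)}` for a map
`i ↦ v(i)` of index sets is allowed, and so is every homomorphism of `K`-algebras. -/
structure CoeffMap (K : Type u) [Field K] (n : ℕ) (k : Type v) [Ring k] [Algebra K k] where
  toLinearMap : (Fin n → K) →ₗ[K] k
  isIdempotentElem : ∀ i, IsIdempotentElem (toLinearMap (Pi.single i 1))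

namespace CoeffMap

variable {K : Type u} [Field K] {n : ℕ} {k : Type v} [Ring k] [Algebra K k]

/-- The image of the idempotent `e_i`. -/
def idem (φ : CoeffMap K n k) (i : Fin n) : k := φ.toLinearMap (Pi.single i 1)

/-- A (not necessarily unital) homomorphism of `K`-algebras is a coefficient map. -/
def ofAlgHom (f : (Fin n → K) →ₙₐ[K] k) : CoeffMap K n k where
  toLinearMap := (f : (Fin n → K) →ₗ[K] k)
  isIdempotentElem i := by
    have h : (Pi.single i 1 : Fin n → K) * Pi.single i 1 = Pi.single i 1 := by
      rw [← Pi.single_mul, one_mul]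
    change f _ * f _ = f _
    rw [← map_mul, h]

/-- The coefficient map `k_n → ⊕_v K e_v`, `e_i ↦ e_{v(i)}`. -/
def ofIndexMap {V : Type v} [DecidableEq V] (f : Fin n → V) : CoeffMap K n (V → K) where
  toLinearMap := ∑ i, (LinearMap.single K (fun _ : V => K) (f i)).comp (LinearMap.proj i)
  isIdempotentElem i := by
    have h : (∑ j, (LinearMap.single K (fun _ : V => K) (f j)).comp (LinearMap.proj j))
        (Pi.single i (1 : K) : Fin n → K) = Pi.single (f i) 1 := by
      simp only [LinearMap.sum_apply, LinearMap.comp_apply, LinearMap.proj_apply]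
      rw [Finset.sum_eq_single i]
      · simp
      · intro j _ hj
        simp [Pi.single_eq_of_ne hj]
      · simp
    rw [h]
    change Pi.single _ _ * Pi.single _ _ = Pi.single _ _
    rw [← Pi.single_mul, one_mul]

/-- The coefficient map `k_n → K`, `e_i ↦ 1` for all `i`. -/
def collapse (K : Type u) [Field K] (n : ℕ) : CoeffMap K n K where
  toLinearMap := ∑ i, LinearMap.proj i
  isIdempotentElem i := by
    simp [IsIdempotentElem, LinearMap.sum_apply, LinearMap.proj_apply, Pi.single_apply]

end CoeffMap

section Internal

variable {K : Type u} [Field K] {n : ℕ} {k : Type v} [Ring k] [Algebra K k]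

/-- The relations between the elements of `k` and the symbols `c^p_{ij}`: the addition,
multiplication and `K`-algebra structure of `k`, the relations `e_j c^p_{ij} = c^p_{ij} = c^p_{ij} e_i`
(products are read from right to left, `c^p_{ij}` going from `i` to `j`), and `c^0_{ij} = 0` for
`i ≥ j`. -/
inductive InternalRel (φ : CoeffMap K n k) :
    FreeAlgebra K (k ⊕ (ℕ × Fin n × Fin n)) → FreeAlgebra K (k ⊕ (ℕ × Fin n × Fin n)) → Prop
  | add (a b : k) : InternalRel φ (FreeAlgebra.ι K (Sum.inl (a + b)))
      (FreeAlgebra.ι K (Sum.inl a) + FreeAlgebra.ι K (Sum.inl b))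
  | mul (a b : k) : InternalRel φ (FreeAlgebra.ι K (Sum.inl (a * b)))
      (FreeAlgebra.ι K (Sum.inl a) * FreeAlgebra.ι K (Sum.inl b))
  | scalar (t : K) : InternalRel φ (FreeAlgebra.ι K (Sum.inl (algebraMap K k t)))
      (algebraMap K _ t)
  | target (p : ℕ) (i j : Fin n) : InternalRel φ
      (FreeAlgebra.ι K (Sum.inl (φ.idem j)) * FreeAlgebra.ι K (Sum.inr (p, i, j)))
      (FreeAlgebra.ι K (Sum.inr (p, i, j)))
  | source (p : ℕ) (i j : Fin n) : InternalRel φ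
      (FreeAlgebra.ι K (Sum.inr (p, i, j)) * FreeAlgebra.ι K (Sum.inl (φ.idem i)))
      (FreeAlgebra.ι K (Sum.inr (p, i, j)))
  | low (i j : Fin n) (h : j ≤ i) : InternalRel φ (FreeAlgebra.ι K (Sum.inr (0, i, j))) 0

/-- The algebra underlying `I_n^k`: freely generated over `k` by the `c^0_{ij}`, `i < j`, and the
`c^p_{ij}`, `p ≥ 1`. -/
def InternalAlg (φ : CoeffMap K n k) : Type (max u v) := RingQuot (InternalRel φ)

instance (φ : CoeffMap K n k) : Ring (InternalAlg φ) :=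
  inferInstanceAs (Ring (RingQuot (InternalRel φ)))

instance (φ : CoeffMap K n k) : Algebra K (InternalAlg φ) :=
  inferInstanceAs (Algebra K (RingQuot (InternalRel φ)))

namespace InternalAlg

/-- The quotient map from the free algebra. -/
def mk (φ : CoeffMap K n k) : FreeAlgebra K (k ⊕ (ℕ × Fin n × Fin n)) →ₐ[K] InternalAlg φ :=
  RingQuot.mkAlgHom K (InternalRel φ)

theorem mk_rel {φ : CoeffMap K n k} {x y : FreeAlgebra K (k ⊕ (ℕ × Fin n × Fin n))}
    (h : InternalRel φ x y) : mk φ x = mk φ y := RingQuot.mkAlgHom_rel K h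

/-- The generator `c^p_{ij}`. -/
def c (φ : CoeffMap K n k) (p : ℕ) (i j : Fin n) : InternalAlg φ :=
  mk φ (FreeAlgebra.ι K (Sum.inr (p, i, j)))

/-- The structure map `k → I_n^k`. -/
def base (φ : CoeffMap K n k) : k →ₐ[K] InternalAlg φ where
  toFun a := mk φ (FreeAlgebra.ι K (Sum.inl a))
  map_one' := by
    have h := mk_rel (InternalRel.scalar (φ := φ) 1)
    simpa only [map_one] using h
  map_zero' := by
    have h := mk_rel (InternalRel.scalar (φ := φ) 0)
    simpa only [map_zero] using h
  map_add' a b := (mk_rel (InternalRel.add (φ := φ) a b)).trans (map_add _ _ _)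
  map_mul' a b := (mk_rel (InternalRel.mul (φ := φ) a b)).trans (map_mul _ _ _)
  commutes' t := (mk_rel (InternalRel.scalar (φ := φ) t)).trans (AlgHom.commutes _ t)

/-- The image of the idempotent `e_i` in `I_n^k`. -/
def e (φ : CoeffMap K n k) (i : Fin n) : InternalAlg φ := base φ (φ.idem i)

theorem e_mul_self (φ : CoeffMap K n k) (i : Fin n) : e φ i * e φ i = e φ i := by
  rw [e, ← map_mul]
  exact congrArg _ (φ.isIdempotentElem i)

theorem e_mul_c (φ : CoeffMap K n k) (p : ℕ) (i j : Fin n) : e φ j * c φ p i j = c φ p i j := by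
  have h := mk_rel (InternalRel.target (φ := φ) p i j)
  rw [map_mul] at h
  exact h

theorem c_mul_e (φ : CoeffMap K n k) (p : ℕ) (i j : Fin n) : c φ p i j * e φ i = c φ p i j := by
  have h := mk_rel (InternalRel.source (φ := φ) p i j)
  rw [map_mul] at h
  exact h

theorem c_zero (φ : CoeffMap K n k) (i j : Fin n) (h : j ≤ i) : c φ 0 i j = 0 := by
  have h := mk_rel (InternalRel.low (φ := φ) i j h)
  rw [map_zero] at h
  exact h

@[elab_as_elim]
theorem induction (φ : CoeffMap K n k) {P : InternalAlg φ → Prop}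
    (hb : ∀ a, P (base φ a)) (hc : ∀ p i j, P (c φ p i j))
    (hadd : ∀ x y, P x → P y → P (x + y)) (hmul : ∀ x y, P x → P y → P (x * y))
    (x : InternalAlg φ) : P x := by
  obtain ⟨y, rfl⟩ : ∃ y, mk φ y = x := RingQuot.mkAlgHom_surjective K (InternalRel φ) x
  induction y using FreeAlgebra.induction with
  | grade0 r =>
    have h := hb (algebraMap K k r)
    rw [AlgHom.commutes] at h
    rwa [AlgHom.commutes]
  | grade1 s =>
    rcases s with a | ⟨p, i, j⟩
    · exact hb a
    · exact hc p i j
  | add a b ha hb' => rw [map_add]; exact hadd _ _ ha hb'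
  | mul a b ha hb' => rw [map_mul]; exact hmul _ _ ha hb'

/-- The universal property of `I_n^k`. -/
def lift (φ : CoeffMap K n k) {B : Type w} [Ring B] [Algebra K B] (f : k →ₐ[K] B)
    (g : ℕ → Fin n → Fin n → B) (h1 : ∀ p i j, f (φ.idem j) * g p i j = g p i j)
    (h2 : ∀ p i j, g p i j * f (φ.idem i) = g p i j)
    (h3 : ∀ i j, j ≤ i → g 0 i j = 0) : InternalAlg φ →ₐ[K] B :=
  RingQuot.liftAlgHom K ⟨FreeAlgebra.lift K (Sum.elim f (fun t => g t.1 t.2.1 t.2.2)), by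
    intro x y h
    induction h with
    | add a b => simp
    | mul a b => simp
    | scalar t => simp
    | target p i j => simpa using h1 p i j
    | source p i j => simpa using h2 p i j
    | low i j h => simpa using h3 i j h⟩

theorem lift_base (φ : CoeffMap K n k) {B : Type w} [Ring B] [Algebra K B] (f : k →ₐ[K] B)
    (g : ℕ → Fin n → Fin n → B) (h1 h2 h3) (a : k) :
    lift φ f g h1 h2 h3 (base φ a) = f a := by
  have h := RingQuot.liftAlgHom_mkAlgHom_apply K
    (FreeAlgebra.lift K (Sum.elim f (fun t : ℕ × Fin n × Fin n => g t.1 t.2.1 t.2.2)))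
    (s := InternalRel φ) (by
      intro x y h
      induction h with
      | add a b => simp
      | mul a b => simp
      | scalar t => simp
      | target p i j => simpa using h1 p i j
      | source p i j => simpa using h2 p i j
      | low i j h => simpa using h3 i j h) (FreeAlgebra.ι K (Sum.inl a))
  exact h.trans (by simp)

theorem lift_c (φ : CoeffMap K n k) {B : Type w} [Ring B] [Algebra K B] (f : k →ₐ[K] B)
    (g : ℕ → Fin n → Fin n → B) (h1 h2 h3) (p : ℕ) (i j : Fin n) :
    lift φ f g h1 h2 h3 (c φ p i j) = g p i j := by
  have h := RingQuot.liftAlgHom_mkAlgHom_apply K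
    (FreeAlgebra.lift K (Sum.elim f (fun t : ℕ × Fin n × Fin n => g t.1 t.2.1 t.2.2)))
    (s := InternalRel φ) (by
      intro x y h
      induction h with
      | add a b => simp
      | mul a b => simp
      | scalar t => simp
      | target p i j => simpa using h1 p i j
      | source p i j => simpa using h2 p i j
      | low i j h => simpa using h3 i j h) (FreeAlgebra.ι K (Sum.inr (p, i, j)))
  exact h.trans (by simp)


theorem hom_ext (φ : CoeffMap K n k) {B : Type w} [Ring B] [Algebra K B]
    {f g : InternalAlg φ →ₐ[K] B} (h1 : ∀ a, f (base φ a) = g (base φ a))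
    (h2 : ∀ p i j, f (c φ p i j) = g (c φ p i j)) : f = g := by
  ext x
  induction x using induction with
  | hb a => exact h1 a
  | hc p i j => exact h2 p i j
  | hadd x y hx hy => rw [map_add, map_add, hx, hy]
  | hmul x y hx hy => rw [map_mul, map_mul, hx, hy]

/-- The degree `1 - 2p + m_j - m_i` of `c^p_{ij}`. -/
def deg (m : Fin n → ℤ) (p : ℕ) (i j : Fin n) : ℤ := 1 - 2 * p + m j - m i

/-- Words in the elements of `k` (of degree `0`) and the generators `c^p_{ij}`. -/
inductive IsWord (φ : CoeffMap K n k) (m : Fin n → ℤ) : ℤ → InternalAlg φ → Prop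
  | base (a : k) : IsWord φ m 0 (base φ a)
  | gen (p : ℕ) (i j : Fin n) : IsWord φ m (deg m p i j) (c φ p i j)
  | mul {s t : ℤ} {x y : InternalAlg φ} (hx : IsWord φ m s x) (hy : IsWord φ m t y) :
      IsWord φ m (s + t) (x * y)

/-- The degree `s` part of `I_n^k`, spanned by the words of degree `s`. -/
def grading (φ : CoeffMap K n k) (m : Fin n → ℤ) (s : ℤ) : Submodule K (InternalAlg φ) :=
  Submodule.span K {x | IsWord φ m s x}

theorem base_mem (φ : CoeffMap K n k) (m : Fin n → ℤ) (a : k) : base φ a ∈ grading φ m 0 :=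
  Submodule.subset_span (IsWord.base a)

theorem c_mem (φ : CoeffMap K n k) (m : Fin n → ℤ) (p : ℕ) (i j : Fin n) :
    c φ p i j ∈ grading φ m (deg m p i j) :=
  Submodule.subset_span (IsWord.gen p i j)

instance gradedMonoid (φ : CoeffMap K n k) (m : Fin n → ℤ) :
    SetLike.GradedMonoid (grading φ m) where
  one_mem := by
    have h := base_mem φ m 1
    rwa [map_one] at h
  mul_mem s t x y hx hy := by
    induction hx using Submodule.span_induction with
    | mem x hx =>
      induction hy using Submodule.span_induction with
      | mem y hy => exact Submodule.subset_span (IsWord.mul hx hy)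
      | zero => rw [mul_zero]; exact Submodule.zero_mem _
      | add y z _ _ h1 h2 => rw [mul_add]; exact Submodule.add_mem _ h1 h2
      | smul a y _ h => rw [mul_smul_comm]; exact Submodule.smul_mem _ _ h
    | zero => rw [zero_mul]; exact Submodule.zero_mem _
    | add y z _ _ h1 h2 => rw [add_mul]; exact Submodule.add_mem _ h1 h2
    | smul a y _ h => rw [smul_mul_assoc]; exact Submodule.smul_mem _ _ h

/-- The decomposition of an element into its homogeneous parts. -/
def decomp (φ : CoeffMap K n k) (m : Fin n → ℤ) : InternalAlg φ →ₐ[K] ⨁ s, grading φ m s :=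
  lift φ
    { toFun a := DirectSum.of (fun s => grading φ m s) 0 ⟨base φ a, base_mem φ m a⟩
      map_one' := by
        rw [DirectSum.one_def]
        exact congrArg _ (Subtype.ext (map_one _))
      map_zero' := by
        rw [← map_zero (DirectSum.of (fun s => grading φ m s) 0)]
        exact congrArg _ (Subtype.ext (map_zero _))
      map_add' a b := by
        rw [← map_add]
        exact congrArg _ (Subtype.ext (map_add _ _ _))
      map_mul' a b := by
        rw [DirectSum.of_mul_of]
        exact DirectSum.of_eq_of_gradedMonoid_eq
          (Sigma.subtype_ext (add_zero 0).symm (map_mul _ _ _))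
      commutes' t := by
        rw [DirectSum.algebraMap_apply]
        exact congrArg _ (Subtype.ext (AlgHom.commutes _ _)) }
    (fun p i j => DirectSum.of (fun s => grading φ m s) (deg m p i j) ⟨c φ p i j, c_mem φ m p i j⟩)
    (fun p i j => by
      change DirectSum.of _ _ _ * _ = _
      rw [DirectSum.of_mul_of]
      exact DirectSum.of_eq_of_gradedMonoid_eq
          (Sigma.subtype_ext (zero_add _) (e_mul_c φ p i j)))
    (fun p i j => by
      change _ * DirectSum.of _ _ _ = _
      rw [DirectSum.of_mul_of]
      exact DirectSum.of_eq_of_gradedMonoid_eq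
          (Sigma.subtype_ext (add_zero _) (c_mul_e φ p i j)))
    (fun i j h => by
      rw [← map_zero (DirectSum.of (fun s => grading φ m s) (deg m 0 i j))]
      exact congrArg _ (Subtype.ext (c_zero φ i j h)))

theorem decomp_word (φ : CoeffMap K n k) (m : Fin n → ℤ) {s : ℤ} {x : InternalAlg φ}
    (h : IsWord φ m s x) :
    decomp φ m x = DirectSum.of (fun s => grading φ m s) s ⟨x, Submodule.subset_span h⟩ := by
  induction h with
  | base a => exact lift_base (B := ⨁ s, grading φ m s) φ _ _ _ _ _ a
  | gen p i j => exact lift_c (B := ⨁ s, grading φ m s) φ _ _ _ _ _ p i j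
  | mul hx hy h1 h2 =>
    rw [map_mul, h1, h2, DirectSum.of_mul_of]
    rfl

theorem isInternal (φ : CoeffMap K n k) (m : Fin n → ℤ) :
    DirectSum.IsInternal (grading φ m) := by
  let G : GradedAlgebra (grading φ m) := GradedAlgebra.ofAlgHom _ (decomp φ m)
    (by
      refine hom_ext φ (fun a => ?_) (fun p i j => ?_)
      · rw [AlgHom.comp_apply, decomp_word φ m (IsWord.base a), DirectSum.coeAlgHom_of]
        rfl
      · rw [AlgHom.comp_apply, decomp_word φ m (IsWord.gen p i j), DirectSum.coeAlgHom_of]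
        rfl)
    (by
      rintro s ⟨x, hx⟩
      induction hx using Submodule.span_induction with
      | mem x hx => exact decomp_word φ m hx
      | zero =>
        rw [map_zero, ← map_zero (DirectSum.of (fun s => grading φ m s) s)]
        rfl
      | add x y hx hy h1 h2 =>
        change decomp φ m (x + y) = _
        rw [map_add]
        refine (congrArg₂ (· + ·) h1 h2).trans ?_
        rw [← map_add]
        rfl
      | smul a x hx h =>
        change decomp φ m (a • x) = _
        rw [map_smul]
        refine (congrArg (a • ·) h).trans ?_
        exact (DirectSum.of_smul (M := fun s => grading φ m s) K s a ⟨x, hx⟩).symm)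
  exact DirectSum.Decomposition.isInternal (grading φ m)

/-- The value of the differential on `c^p_{ij}`. As `c^0_{ij} = 0` for `i ≥ j`, the sums over `r` are
not restricted. -/
def dGen (φ : CoeffMap K n k) (m : Fin n → ℤ) (p : ℕ) (i j : Fin n) : InternalAlg φ :=
  (if p = 1 ∧ i = j then e φ i else 0) +
    ∑ q ∈ Finset.HasAntidiagonal.antidiagonal p, ∑ r : Fin n,
      (m r + m j).negOnePow • (c φ q.1 r j * c φ q.2 i r)

theorem e_mul_dGen (φ : CoeffMap K n k) (m : Fin n → ℤ) (p : ℕ) (i j : Fin n) :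
    e φ j * dGen φ m p i j = dGen φ m p i j := by
  rw [dGen, mul_add, Finset.mul_sum]
  congr 1
  · split_ifs with h
    · rw [h.2, e_mul_self]
    · rw [mul_zero]
  · refine Finset.sum_congr rfl fun q _ => ?_
    rw [Finset.mul_sum]
    refine Finset.sum_congr rfl fun r _ => ?_
    rw [mul_smul_comm, ← mul_assoc, e_mul_c]

theorem dGen_mul_e (φ : CoeffMap K n k) (m : Fin n → ℤ) (p : ℕ) (i j : Fin n) :
    dGen φ m p i j * e φ i = dGen φ m p i j := by
  rw [dGen, add_mul, Finset.sum_mul]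
  congr 1
  · split_ifs with h
    · rw [e_mul_self]
    · rw [zero_mul]
  · refine Finset.sum_congr rfl fun q _ => ?_
    rw [Finset.sum_mul]
    refine Finset.sum_congr rfl fun r _ => ?_
    rw [smul_mul_assoc, mul_assoc, c_mul_e]

theorem dGen_zero (φ : CoeffMap K n k) (m : Fin n → ℤ) (i j : Fin n) (h : j ≤ i) :
    dGen φ m 0 i j = 0 := by
  rw [dGen, if_neg (by simp), zero_add]
  refine Finset.sum_eq_zero fun q hq => Finset.sum_eq_zero fun r _ => ?_
  have hq1 : q.1 = 0 := by have := Finset.HasAntidiagonal.mem_antidiagonal.1 hq; omega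
  have hq2 : q.2 = 0 := by have := Finset.HasAntidiagonal.mem_antidiagonal.1 hq; omega
  rw [hq1, hq2]
  rcases le_total r i with hr | hr
  · rw [c_zero φ i r hr, mul_zero, smul_zero]
  · rw [c_zero φ r j (h.trans hr), zero_mul, smul_zero]

/-- The algebra map `x ↦ ((σ x, ∂ x), (0, x))` to `2 × 2` matrices, where `σ x = (-1) ^ |x| x`; that it
is multiplicative is the graded Leibniz rule. -/
def dMatrix (φ : CoeffMap K n k) (m : Fin n → ℤ) :
    InternalAlg φ →ₐ[K] Matrix (Fin 2) (Fin 2) (InternalAlg φ) :=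
  lift φ ((Matrix.scalarAlgHom (Fin 2) K).comp (base φ))
    (fun p i j => !![(deg m p i j).negOnePow • c φ p i j, dGen φ m p i j; 0, c φ p i j])
    (fun p i j => by
      have h1 := e_mul_c φ p i j
      have h2 := e_mul_dGen φ m p i j
      rw [e] at h1 h2
      ext a b
      fin_cases a <;> fin_cases b <;>
        simp [Matrix.mul_apply, Matrix.scalar_apply, Matrix.diagonal, h1, h2, mul_smul_comm])
    (fun p i j => by
      have h1 := c_mul_e φ p i j
      have h2 := dGen_mul_e φ m p i j
      rw [e] at h1 h2
      ext a b
      fin_cases a <;> fin_cases b <;>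
        simp [Matrix.mul_apply, Matrix.scalar_apply, Matrix.diagonal, h1, h2, smul_mul_assoc])
    (fun i j h => by
      rw [c_zero φ i j h, dGen_zero φ m i j h]
      ext a b
      fin_cases a <;> fin_cases b <;> simp)

/-- The differential of `I_n^k`. -/
def d (φ : CoeffMap K n k) (m : Fin n → ℤ) : InternalAlg φ →ₗ[K] InternalAlg φ :=
  (Matrix.entryLinearMap K (InternalAlg φ) (0 : Fin 2) (1 : Fin 2)).comp (dMatrix φ m).toLinearMap

theorem d_apply (φ : CoeffMap K n k) (m : Fin n → ℤ) (x : InternalAlg φ) :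
    d φ m x = dMatrix φ m x 0 1 := rfl

theorem dMatrix_base (φ : CoeffMap K n k) (m : Fin n → ℤ) (a : k) :
    dMatrix φ m (base φ a) = Matrix.scalar (Fin 2) (base φ a) := lift_base ..

theorem dMatrix_c (φ : CoeffMap K n k) (m : Fin n → ℤ) (p : ℕ) (i j : Fin n) :
    dMatrix φ m (c φ p i j) =
      !![(deg m p i j).negOnePow • c φ p i j, dGen φ m p i j; 0, c φ p i j] := lift_c ..

theorem d_base (φ : CoeffMap K n k) (m : Fin n → ℤ) (a : k) : d φ m (base φ a) = 0 := by
  rw [d_apply, dMatrix_base]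
  simp

theorem d_c (φ : CoeffMap K n k) (m : Fin n → ℤ) (p : ℕ) (i j : Fin n) :
    d φ m (c φ p i j) = dGen φ m p i j := by
  rw [d_apply, dMatrix_c]
  simp

theorem dMatrix_lower (φ : CoeffMap K n k) (m : Fin n → ℤ) (x : InternalAlg φ) :
    dMatrix φ m x 1 0 = 0 ∧ dMatrix φ m x 1 1 = x := by
  induction x using induction with
  | hb a => rw [dMatrix_base]; simp
  | hc p i j => rw [dMatrix_c]; simp
  | hadd x y hx hy =>
    rw [map_add, Matrix.add_apply, Matrix.add_apply, hx.1, hx.2, hy.1, hy.2]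
    simp
  | hmul x y hx hy =>
    rw [map_mul, Matrix.mul_apply, Matrix.mul_apply, Fin.sum_univ_two, Fin.sum_univ_two,
      hx.1, hx.2, hy.1, hy.2]
    simp

theorem d_mul (φ : CoeffMap K n k) (m : Fin n → ℤ) (x y : InternalAlg φ) :
    d φ m (x * y) = d φ m x * y + dMatrix φ m x 0 0 * d φ m y := by
  rw [d_apply, map_mul, Matrix.mul_apply, Fin.sum_univ_two, (dMatrix_lower φ m y).2, add_comm]
  rfl

theorem dMatrix_sign (φ : CoeffMap K n k) (m : Fin n → ℤ) {s : ℤ} {x : InternalAlg φ}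
    (hx : x ∈ grading φ m s) : dMatrix φ m x 0 0 = s.negOnePow • x := by
  induction hx using Submodule.span_induction with
  | mem x hx =>
    induction hx with
    | base a => rw [dMatrix_base]; simp
    | gen p i j => rw [dMatrix_c]; simp
    | mul hx hy h1 h2 =>
      rw [map_mul, Matrix.mul_apply, Fin.sum_univ_two, (dMatrix_lower φ m _).1, h1, h2,
        Int.negOnePow_add, mul_zero, add_zero, smul_mul_smul_comm]
  | zero => simp
  | add y z _ _ h1 h2 => rw [map_add, Matrix.add_apply, h1, h2, smul_add]
  | smul a y _ h => rw [map_smul, Matrix.smul_apply, h, smul_comm]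

theorem d_leibniz (φ : CoeffMap K n k) (m : Fin n → ℤ) (s : ℤ) (x y : InternalAlg φ)
    (hx : x ∈ grading φ m s) :
    d φ m (x * y) = d φ m x * y + s.negOnePow • (x * d φ m y) := by
  rw [d_mul, dMatrix_sign φ m hx, smul_mul_assoc]

theorem units_smul_mem {V : Type w} [AddCommGroup V] [Module K V] (W : Submodule K V) (t : ℤˣ)
    {x : V} (hx : x ∈ W) : t • x ∈ W := by
  rcases Int.units_eq_one_or t with h | h
  · rwa [h, one_smul]
  · rw [h, Units.neg_smul, one_smul]
    exact W.neg_mem hx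

theorem dGen_mem (φ : CoeffMap K n k) (m : Fin n → ℤ) (p : ℕ) (i j : Fin n) :
    dGen φ m p i j ∈ grading φ m (deg m p i j + 1) := by
  refine Submodule.add_mem _ ?_ (Submodule.sum_mem _ fun q hq => Submodule.sum_mem _ fun r _ => ?_)
  · split_ifs with h
    · have h1 : deg m p i j + 1 = 0 := by
        rw [h.1, h.2, deg]
        push_cast
        ring
      rw [h1]
      exact base_mem φ m _
    · exact Submodule.zero_mem _
  · have h1 : deg m p i j + 1 = deg m q.1 r j + deg m q.2 i r := by
      have h2 : (p : ℤ) = q.1 + q.2 := by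
        exact_mod_cast (Finset.HasAntidiagonal.mem_antidiagonal.1 hq).symm
      rw [deg, deg, deg, h2]
      ring
    rw [h1]
    exact units_smul_mem _ _ ((gradedMonoid φ m).mul_mem (c_mem φ m _ _ _) (c_mem φ m _ _ _))

theorem d_mem (φ : CoeffMap K n k) (m : Fin n → ℤ) (s : ℤ) (x : InternalAlg φ)
    (hx : x ∈ grading φ m s) : d φ m x ∈ grading φ m (s + 1) := by
  induction hx using Submodule.span_induction with
  | mem x hx =>
    induction hx with
    | base a => rw [d_base]; exact Submodule.zero_mem _
    | gen p i j => rw [d_c]; exact dGen_mem φ m p i j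
    | @mul s t x y hx hy h1 h2 =>
      rw [d_leibniz φ m s x y (Submodule.subset_span hx)]
      refine Submodule.add_mem _ ?_ (units_smul_mem _ _ ?_)
      · have h3 : s + t + 1 = (s + 1) + t := by ring
        rw [h3]
        exact (gradedMonoid φ m).mul_mem h1 (Submodule.subset_span hy)
      · rw [add_assoc]
        exact (gradedMonoid φ m).mul_mem (Submodule.subset_span hx) h2
  | zero => rw [map_zero]; exact Submodule.zero_mem _
  | add y z _ _ h1 h2 => rw [map_add]; exact Submodule.add_mem _ h1 h2
  | smul a y _ h => rw [map_smul]; exact Submodule.smul_mem _ _ h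

theorem sum_antidiagonal_assoc {M : Type w} [AddCommMonoid M] (p : ℕ) (f : ℕ → ℕ → ℕ → M) :
    ∑ q ∈ Finset.HasAntidiagonal.antidiagonal p,
      ∑ q' ∈ Finset.HasAntidiagonal.antidiagonal q.1, f q'.1 q'.2 q.2 =
    ∑ q ∈ Finset.HasAntidiagonal.antidiagonal p,
      ∑ q' ∈ Finset.HasAntidiagonal.antidiagonal q.2, f q.1 q'.1 q'.2 := by
  rw [Finset.sum_sigma', Finset.sum_sigma']
  refine Finset.sum_nbij' (fun x => ⟨(x.2.1, x.2.2 + x.1.2), (x.2.2, x.1.2)⟩)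
    (fun x => ⟨(x.1.1 + x.2.1, x.2.2), (x.1.1, x.2.1)⟩) ?_ ?_ ?_ ?_ ?_
  · rintro ⟨⟨a, b⟩, ⟨a', b'⟩⟩ h
    simp only [Finset.mem_sigma, Finset.HasAntidiagonal.mem_antidiagonal] at h ⊢
    exact ⟨by omega, by trivial⟩
  · rintro ⟨⟨a, b⟩, ⟨a', b'⟩⟩ h
    simp only [Finset.mem_sigma, Finset.HasAntidiagonal.mem_antidiagonal] at h ⊢
    exact ⟨by omega, by trivial⟩
  · rintro ⟨⟨a, b⟩, ⟨a', b'⟩⟩ h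
    simp only [Finset.mem_sigma, Finset.HasAntidiagonal.mem_antidiagonal] at h
    obtain ⟨h1, rfl⟩ := h
    rfl
  · rintro ⟨⟨a, b⟩, ⟨a', b'⟩⟩ h
    simp only [Finset.mem_sigma, Finset.HasAntidiagonal.mem_antidiagonal] at h
    obtain ⟨h1, rfl⟩ := h
    rfl
  · rintro ⟨⟨a, b⟩, ⟨a', b'⟩⟩ h
    rfl

theorem d_cc (φ : CoeffMap K n k) (m : Fin n → ℤ) (p q : ℕ) (i r j : Fin n) :
    d φ m ((m r + m j).negOnePow • (c φ p r j * c φ q i r)) =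
      (m r + m j).negOnePow • (dGen φ m p r j * c φ q i r) - c φ p r j * dGen φ m q i r := by
  have h1 : (deg m p r j).negOnePow = -(m r + m j).negOnePow := by
    rw [← Int.negOnePow_succ, Int.negOnePow_eq_iff, deg]
    exact ⟨-p - m r, by ring⟩
  have h2 : (m r + m j).negOnePow * (m r + m j).negOnePow = 1 := Int.units_mul_self _
  rw [Units.smul_def, map_zsmul, d_leibniz φ m _ _ _ (c_mem φ m p r j), d_c, d_c, h1,
    ← Units.smul_def, smul_add, smul_smul, mul_neg, h2, Units.neg_smul, one_smul, sub_eq_add_neg]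

theorem d_dGen (φ : CoeffMap K n k) (m : Fin n → ℤ) (p : ℕ) (i j : Fin n) :
    d φ m (dGen φ m p i j) = 0 := by
  have h0 : d φ m (if p = 1 ∧ i = j then e φ i else 0) = 0 := by
    split_ifs
    · exact d_base φ m _
    · exact map_zero _
  have hsign : ∀ r t : Fin n, (m r + m j).negOnePow * (m t + m j).negOnePow =
      (m r + m t).negOnePow := by
    intro r t
    rw [← Int.negOnePow_add, Int.negOnePow_eq_iff]
    exact ⟨m j, by ring⟩
  have hL : ∑ q ∈ Finset.HasAntidiagonal.antidiagonal p, ∑ r : Fin n,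
      (m r + m j).negOnePow • (dGen φ m q.1 r j * c φ q.2 i r) =
      (∑ q ∈ Finset.HasAntidiagonal.antidiagonal p, if q.1 = 1 then c φ q.2 i j else 0) +
      ∑ q ∈ Finset.HasAntidiagonal.antidiagonal p,
        ∑ q' ∈ Finset.HasAntidiagonal.antidiagonal q.1, ∑ r : Fin n, ∑ t : Fin n,
        (m r + m t).negOnePow • (c φ q'.1 t j * c φ q'.2 r t * c φ q.2 i r) := by
    rw [← Finset.sum_add_distrib]
    refine Finset.sum_congr rfl fun q _ => ?_
    have hr : ∀ r : Fin n, (m r + m j).negOnePow • (dGen φ m q.1 r j * c φ q.2 i r) =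
        (if r = j then (if q.1 = 1 then c φ q.2 i j else 0) else 0) +
        ∑ q' ∈ Finset.HasAntidiagonal.antidiagonal q.1, ∑ t : Fin n,
          (m r + m t).negOnePow • (c φ q'.1 t j * c φ q'.2 r t * c φ q.2 i r) := by
      intro r
      rw [dGen, add_mul, smul_add, Finset.sum_mul, Finset.smul_sum]
      congr 1
      · by_cases h1 : r = j
        · subst h1
          by_cases h2 : q.1 = 1
          · have h3 : (m r + m r).negOnePow = 1 := by
              rw [Int.negOnePow_add, Int.units_mul_self]
            simp [h2, e_mul_c, h3]
          · simp [h2]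
        · simp [h1]
      · refine Finset.sum_congr rfl fun q' _ => ?_
        rw [Finset.sum_mul, Finset.smul_sum]
        refine Finset.sum_congr rfl fun t _ => ?_
        rw [smul_mul_assoc, smul_smul, hsign]
    rw [Finset.sum_congr rfl fun r _ => hr r, Finset.sum_add_distrib, Finset.sum_ite_eq' ,
      if_pos (Finset.mem_univ j), Finset.sum_comm]
  have hR : ∑ q ∈ Finset.HasAntidiagonal.antidiagonal p, ∑ r : Fin n,
      c φ q.1 r j * dGen φ m q.2 i r =
      (∑ q ∈ Finset.HasAntidiagonal.antidiagonal p, if q.2 = 1 then c φ q.1 i j else 0) +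
      ∑ q ∈ Finset.HasAntidiagonal.antidiagonal p,
        ∑ q' ∈ Finset.HasAntidiagonal.antidiagonal q.2, ∑ r : Fin n, ∑ t : Fin n,
        (m r + m t).negOnePow • (c φ q.1 t j * c φ q'.1 r t * c φ q'.2 i r) := by
    rw [← Finset.sum_add_distrib]
    refine Finset.sum_congr rfl fun q _ => ?_
    have hr : ∀ r : Fin n, c φ q.1 r j * dGen φ m q.2 i r =
        (if i = r then (if q.2 = 1 then c φ q.1 i j else 0) else 0) +
        ∑ q' ∈ Finset.HasAntidiagonal.antidiagonal q.2, ∑ t : Fin n,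
          (m t + m r).negOnePow • (c φ q.1 r j * c φ q'.1 t r * c φ q'.2 i t) := by
      intro r
      rw [dGen, mul_add, Finset.mul_sum]
      congr 1
      · by_cases h1 : i = r
        · subst h1
          by_cases h2 : q.2 = 1
          · simp [h2, c_mul_e]
          · simp [h2]
        · simp [h1]
      · refine Finset.sum_congr rfl fun q' _ => ?_
        rw [Finset.mul_sum]
        refine Finset.sum_congr rfl fun t _ => ?_
        rw [mul_smul_comm, mul_assoc]
    rw [Finset.sum_congr rfl fun r _ => hr r, Finset.sum_add_distrib, Finset.sum_ite_eq,
      if_pos (Finset.mem_univ i), Finset.sum_comm]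
    congr 1
    refine Finset.sum_congr rfl fun q' _ => ?_
    rw [Finset.sum_comm]
  have hswap : (∑ q ∈ Finset.HasAntidiagonal.antidiagonal p,
      if q.1 = 1 then c φ q.2 i j else 0) =
      ∑ q ∈ Finset.HasAntidiagonal.antidiagonal p, if q.2 = 1 then c φ q.1 i j else 0 :=
    (Finset.sum_equiv (Equiv.prodComm ℕ ℕ) (fun q => by
      simp [Finset.HasAntidiagonal.mem_antidiagonal, add_comm]) (fun q _ => rfl))
  rw [dGen, map_add, h0, zero_add, map_sum]
  simp only [map_sum, d_cc, Finset.sum_sub_distrib]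
  rw [hL, hR, hswap, sum_antidiagonal_assoc p (fun a b b' => ∑ r : Fin n, ∑ t : Fin n,
        (m r + m t).negOnePow • (c φ a t j * c φ b r t * c φ b' i r)), sub_self]

theorem d_d (φ : CoeffMap K n k) (m : Fin n → ℤ) (x : InternalAlg φ) :
    d φ m (d φ m x) = 0 := by
  have hw : ∀ (s : ℤ) (x : InternalAlg φ), IsWord φ m s x → d φ m (d φ m x) = 0 := by
    intro s x hx
    induction hx with
    | base a => rw [d_base, map_zero]
    | gen p i j => rw [d_c, d_dGen]
    | @mul s t x y hx hy h1 h2 =>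
      have hx' : x ∈ grading φ m s := Submodule.subset_span hx
      rw [d_leibniz φ m s x y hx', map_add, d_leibniz φ m _ _ _ (d_mem φ m s x hx'), h1,
        Units.smul_def s.negOnePow, map_zsmul, d_leibniz φ m s _ _ hx', h2, Int.negOnePow_succ]
      rw [mul_zero, smul_zero, zero_mul, add_zero, zero_add, Units.neg_smul, ← Units.smul_def,
        neg_add_cancel]
  have htop : (⨆ s, grading φ m s) = ⊤ := (isInternal φ m).submodule_iSup_eq_top
  have hx : x ∈ ⨆ s, grading φ m s := htop ▸ Submodule.mem_top
  have hle : (⨆ s, grading φ m s) ≤ LinearMap.ker ((d φ m).comp (d φ m)) :=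
    iSup_le fun s => Submodule.span_le.2 fun y hy => hw s y hy
  exact hle hx

/-- The subalgebra `A_n^k` of `I_n^k` generated over `k` by the `c^0_{ij}` and the `c^1_{ij}`. -/
def small (φ : CoeffMap K n k) : Subalgebra K (InternalAlg φ) :=
  Algebra.adjoin K (Set.range (base φ) ∪ {x | ∃ p i j, p ≤ 1 ∧ x = c φ p i j})

theorem base_mem_small (φ : CoeffMap K n k) (a : k) : base φ a ∈ small φ :=
  Algebra.subset_adjoin (Or.inl ⟨a, rfl⟩)

theorem c_mem_small (φ : CoeffMap K n k) {p : ℕ} (hp : p ≤ 1) (i j : Fin n) :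
    c φ p i j ∈ small φ :=
  Algebra.subset_adjoin (Or.inr ⟨p, i, j, hp, rfl⟩)

theorem dGen_mem_small (φ : CoeffMap K n k) (m : Fin n → ℤ) {p : ℕ} (hp : p ≤ 1) (i j : Fin n) :
    dGen φ m p i j ∈ small φ := by
  refine add_mem ?_ (sum_mem fun q hq => sum_mem fun r _ => ?_)
  · split_ifs
    · exact base_mem_small φ _
    · exact zero_mem _
  · have h := Finset.HasAntidiagonal.mem_antidiagonal.1 hq
    exact units_smul_mem (Subalgebra.toSubmodule (small φ)) _ (mul_mem (S := Subalgebra K _)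
      (c_mem_small φ (by omega) _ _) (c_mem_small φ (by omega) _ _))

theorem d_mem_small (φ : CoeffMap K n k) (m : Fin n → ℤ) (x : InternalAlg φ)
    (hx : x ∈ small φ) : d φ m x ∈ small φ := by
  suffices h : dMatrix φ m x 0 0 ∈ small φ ∧ d φ m x ∈ small φ from h.2
  induction hx using Algebra.adjoin_induction with
  | mem x hx =>
    rcases hx with ⟨a, rfl⟩ | ⟨p, i, j, hp, rfl⟩
    · rw [d_base, dMatrix_base]
      exact ⟨by simpa using base_mem_small φ a, zero_mem _⟩
    · rw [d_c, dMatrix_sign φ m (c_mem φ m p i j)]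
      exact ⟨units_smul_mem (Subalgebra.toSubmodule (small φ)) _ (c_mem_small φ hp i j),
        dGen_mem_small φ m hp i j⟩
  | algebraMap t =>
    rw [← AlgHom.commutes (base φ), d_base, dMatrix_base]
    exact ⟨by simp, zero_mem _⟩
  | add x y hx hy h1 h2 =>
    rw [map_add, map_add, Matrix.add_apply]
    exact ⟨add_mem h1.1 h2.1, add_mem h1.2 h2.2⟩
  | mul x y hx hy h1 h2 =>
    rw [d_mul, map_mul, Matrix.mul_apply, Fin.sum_univ_two, (dMatrix_lower φ m y).1, mul_zero,
      add_zero]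
    exact ⟨mul_mem h1.1 h2.1, add_mem (mul_mem h1.2 hy) (mul_mem h1.1 h2.2)⟩

theorem small_graded (φ : CoeffMap K n k) (m : Fin n → ℤ) (x : InternalAlg φ) (hx : x ∈ small φ) :
    x ∈ ⨆ s, Subalgebra.toSubmodule (small φ) ⊓ grading φ m s := by
  have hmono : ∀ s, Subalgebra.toSubmodule (small φ) ⊓ grading φ m s ≤
      ⨆ s, Subalgebra.toSubmodule (small φ) ⊓ grading φ m s :=
    le_iSup (fun s => Subalgebra.toSubmodule (small φ) ⊓ grading φ m s)
  induction hx using Algebra.adjoin_induction with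
  | mem x hx =>
    rcases hx with ⟨a, rfl⟩ | ⟨p, i, j, hp, rfl⟩
    · exact hmono 0 ⟨base_mem_small φ a, base_mem φ m a⟩
    · exact hmono _ ⟨c_mem_small φ hp i j, c_mem φ m p i j⟩
  | algebraMap t =>
    rw [← AlgHom.commutes (base φ)]
    exact hmono 0 ⟨base_mem_small φ _, base_mem φ m _⟩
  | add x y hx hy h1 h2 => exact add_mem h1 h2
  | mul x y hx hy h1 h2 =>
    have h := Submodule.mul_mem_mul h1 h2
    rw [Submodule.iSup_mul] at h
    simp only [Submodule.mul_iSup] at h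
    suffices hle : (⨆ s, ⨆ t, (Subalgebra.toSubmodule (small φ) ⊓ grading φ m s) *
        (Subalgebra.toSubmodule (small φ) ⊓ grading φ m t)) ≤
        ⨆ s, Subalgebra.toSubmodule (small φ) ⊓ grading φ m s from hle h
    refine iSup_le fun s => iSup_le fun t => ?_
    refine Submodule.mul_le.2 fun a ha b hb => ?_
    exact hmono (s + t) ⟨show a * b ∈ small φ from mul_mem ha.1 hb.1,
      (gradedMonoid φ m).mul_mem ha.2 hb.2⟩

end InternalAlg

/-- The internal DG-algebra `I_n^k`, for the grading integers `m_1, …, m_n`. -/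
def internalDG (φ : CoeffMap K n k) (m : Fin n → ℤ) : DGAlgebra.{u, max u v} K where
  carrier := InternalAlg φ
  grading := InternalAlg.grading φ m
  gradedMonoid := InternalAlg.gradedMonoid φ m
  isInternal := InternalAlg.isInternal φ m
  d := InternalAlg.d φ m
  d_mem := InternalAlg.d_mem φ m
  d_d := InternalAlg.d_d φ m
  leibniz := InternalAlg.d_leibniz φ m

/-- The DG-subalgebra `A_n^k` of `I_n^k`. -/
def smallDG (φ : CoeffMap K n k) (m : Fin n → ℤ) : DGAlgebra.{u, max u v} K :=
  (internalDG φ m).sub (InternalAlg.small φ) (InternalAlg.d_mem_small φ m)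
    (InternalAlg.small_graded φ m)

/-- The inclusion `A_n^k → I_n^k`. -/
def smallIncl (φ : CoeffMap K n k) (m : Fin n → ℤ) :
    (smallDG φ m).Hom (internalDG φ m) where
  toAlgHom := (InternalAlg.small φ).val
  map_mem _ _ hx := hx
  comm _ := rfl

/-- The word `c^1_{k_l j} ⋯ c^1_{k_1 k_2} c^1_{i k_1}` of length `l + 1`. -/
def pathWord (φ : CoeffMap K n k) (j : Fin n) : Fin n → List (Fin n) → InternalAlg φ
  | i, [] => InternalAlg.c φ 1 i j
  | i, r :: l => pathWord φ j r l * InternalAlg.c φ 1 i r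

/-- `r : I_n^k → A_n^k` is the retraction: the identity on `A_n^k`, and for `p > 1`
`r(c^p_{ij}) = C_{p-1} ∑_{k_1, …, k_{2p-2}} (-1)^{m_{k_1} + ⋯ + m_{k_{2p-2}}}
  c^1_{k_{2p-2} j} ⋯ c^1_{k_1 k_2} c^1_{i k_1}` with `C_{p-1}` the Catalan number. -/
def IsRetraction (φ : CoeffMap K n k) (m : Fin n → ℤ)
    (r : (internalDG φ m).Hom (smallDG φ m)) : Prop :=
  (∀ x, r (smallIncl φ m x) = x) ∧
  ∀ (p : ℕ) (i j : Fin n), 1 < p →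
    smallIncl φ m (r (InternalAlg.c φ p i j)) =
      catalan (p - 1) • ∑ κ : Fin (2 * p - 2) → Fin n,
        (∑ t, m (κ t)).negOnePow • pathWord φ j i (List.ofFn κ)

end Internal

end

noncomputable section

/-! ## A criterion for quasi-isomorphisms -/

/-! Retraction. Let `M_p` be the matrix with entry `(-1)^{m_j} c^p_{ij}` in row `j` and column `i`,
`E` the diagonal matrix of the idempotents, and `D` the entrywise differential with the sign
`(-1)^{m_j}` in row `j`. All signs are then absorbed: `D M_p = δ_{p1} E + ∑_{a+b=p} M_a M_b`, and
`D` is an odd derivation for which every `M_p` is odd (`twist_d_cMat`, `conjMap_sgn_cMat`). Since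
`E` commutes with `M_1`, it cancels in `D(M_1²)`, which is the commutator `[M_0, M_1²]`. Hence the
matrices `R_0 = M_0`, `R_p = C_{p-1} M_1^{2p-1}` satisfy the same structure equation as the `M_p`;
the quadratic terms match by the Catalan recurrence (`twist_d_retrMat`). So `M_p ↦ R_p` defines a
DG-morphism `r`, and expanding the matrix power gives the sum over paths (`cMat_pow_apply`).

The map `r` splits the inclusion, so the remaining point is that `x - r x` is a boundary for every
cocycle `x`. As `D M_1` contains `E`, left multiplication by `M_1` is a contraction up to lower
terms: put `h(M_p) = M_1 M_p` for `p ≥ 2`, `h = 0` on the other generators, and extend by `h(xy) =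
h(x) y + σ(r x) h(y)`, with `σ` the grading sign. The error `1 - r - (∂h + h∂)` commutes with `∂`
and strictly lowers the weight in which `c^p` counts `p - 1`; on weight `0` it vanishes
(`defect_mem_weight`). Induction on the weight concludes (`exists_d_eq_sub_retr`).

Laurent polynomials. For `n = 2` with both idempotents sent to `1`, let `ε = (-1)^{m_0+m_1}` and let
`π` send `c^0_{01}` to `z`, `c^1_{10}` to `-ε z⁻¹` and all other generators to `0`. Powers of the
cocycles `c^0_{01}` and `y = -ε c^1_{10}` give a linear section `s` by cocycles, so `π` is
surjective on cohomology. The section is not multiplicative, but it is linear over `I_2` up to a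
homotopy `μ`: `v s(ρ) - s(π(v) ρ) = ∂ μ(v, ρ) + μ(∂v, ρ)` (`merge_identity`). At `ρ = 1` this
exhibits each cocycle in the kernel of `π` as a boundary. The homotopy is read off from the
differential: `c^p_{1j} c^0_{01}` is a summand of `∂c^p_{0j}`, and `c^p_{0j} c^1_{10}` is one of
`∂c^{p+1}_{1j}`, up to sign.

In both halves the twisted derivations are obtained from the universal property as off-diagonal
entries of triangular representations, and identities between them are checked on generators. -/

open CategoryTheory in
-- Homology is modelled as kernel modulo range, where injectivity and surjectivity can be tested on
-- representing elements.
theorem quasiIso_of_moduleCat {R : Type u} [Ring R] {S T : ShortComplex (ModuleCat.{w} R)}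
    (f : S ⟶ T)
    (hinj : ∀ x : S.X₂, S.g x = 0 → ∀ y : T.X₁, T.f y = f.τ₂ x → ∃ z : S.X₁, S.f z = x)
    (hsurj : ∀ y : T.X₂, T.g y = 0 → ∃ x : S.X₂, S.g x = 0 ∧ f.τ₂ x = y) :
    ShortComplex.QuasiIso f := by
  have γ : ShortComplex.LeftHomologyMapData f S.moduleCatLeftHomologyData
    T.moduleCatLeftHomologyData := default
  have hK : ∀ x : LinearMap.ker S.g.hom, (γ.φK x : LinearMap.ker T.g.hom).1 = f.τ₂ x.1 :=
    fun x => by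
      have h := ConcreteCategory.congr_hom γ.commi x
      exact h
  have hH : ∀ x : LinearMap.ker S.g.hom, γ.φH (Submodule.Quotient.mk x) =
      Submodule.Quotient.mk (p := LinearMap.range T.moduleCatToCycles) (γ.φK x) :=
    fun x => ConcreteCategory.congr_hom γ.commπ x
  rw [γ.quasiIso_iff, ConcreteCategory.isIso_iff_bijective]
  constructor
  · refine (injective_iff_map_eq_zero γ.φH.hom).2 fun a ha => ?_
    obtain ⟨x, rfl⟩ := Submodule.Quotient.mk_surjective _ a
    have h1 := (hH x).symm.trans ha
    obtain ⟨y, hy⟩ := (Submodule.Quotient.mk_eq_zero _).1 h1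
    obtain ⟨z, hz⟩ := hinj x.1 x.2 y ((congrArg Subtype.val hy).trans (hK x))
    exact (Submodule.Quotient.mk_eq_zero _).2 ⟨z, Subtype.ext hz⟩
  · intro b
    obtain ⟨y, rfl⟩ := Submodule.Quotient.mk_surjective _ b
    obtain ⟨x, hx, hxy⟩ := hsurj y.1 y.2
    refine ⟨Submodule.Quotient.mk ⟨x, hx⟩, (hH _).trans ?_⟩
    congr 1
    exact Subtype.ext ((hK _).trans hxy)

namespace DGAlgebra

variable {K : Type u} [Field K]

/-- If a homogeneous element is a boundary, it is the boundary of a homogeneous element. -/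
theorem exists_homogeneous_primitive (D : DGAlgebra.{u, w} K) {i : ℤ} {x : D.carrier}
    (hx : x ∈ D.grading (i + 1)) {y : D.carrier} (hy : D.d y = x) :
    ∃ z ∈ D.grading i, D.d z = x := by
  classical
  let dec : DirectSum.Decomposition D.grading := D.isInternal.chooseDecomposition
  refine ⟨DirectSum.decompose D.grading y i, SetLike.coe_mem _, ?_⟩
  -- Passing to homogeneous components commutes with `d` up to the shift of degree, so the degree
  -- `i` component of any primitive is again a primitive.
  have hcomp : ∀ (y : D.carrier) (i : ℤ),
      (DirectSum.decompose D.grading (D.d y) (i + 1) : D.carrier) =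
        D.d (DirectSum.decompose D.grading y i) := by
    intro y i
    induction y using DirectSum.Decomposition.inductionOn D.grading with
    | zero => simp
    | @homogeneous j a =>
      by_cases h : j = i
      · subst h
        rw [DirectSum.decompose_of_mem_same D.grading a.2,
          DirectSum.decompose_of_mem_same D.grading (D.d_mem _ _ a.2)]
      · rw [DirectSum.decompose_of_mem_ne D.grading a.2 h,
          DirectSum.decompose_of_mem_ne D.grading (D.d_mem _ _ a.2) (by omega), map_zero]
    | add a b ha hb =>
      rw [map_add, DirectSum.decompose_add, DirectSum.decompose_add, DirectSum.add_apply,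
        DirectSum.add_apply, Submodule.coe_add, Submodule.coe_add, map_add, ha, hb]
  rw [← hcomp, hy, DirectSum.decompose_of_mem_same D.grading hx]

/-- Injectivity may ignore degrees, because an inhomogeneous primitive can be replaced by one of its
components. Surjectivity cannot: the preimage must lie in the given degree. -/
theorem Hom.isQuasiIso_of_cocycles {D E : DGAlgebra.{u, w} K} (f : Hom D E)
    (hinj : ∀ x, D.d x = 0 → ∀ y, E.d y = f x → ∃ z, D.d z = x)
    (hsurj : ∀ i, ∀ y ∈ E.grading i, E.d y = 0 → ∃ x ∈ D.grading i, D.d x = 0 ∧ f x = y) :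
    f.IsQuasiIso := by
  refine ⟨fun i => ?_⟩
  -- With the degree written as `j + 1`, both adjacent differentials have the form `i → i + 1` in
  -- which the complex is defined.
  obtain ⟨j, rfl⟩ : ∃ j, i = j + 1 := ⟨i - 1, by ring⟩
  rw [quasiIsoAt_iff' f.chainMap j (j + 1) (j + 1 + 1) (by simp) (by simp)]
  have hd : ∀ (D : DGAlgebra.{u, w} K) (i : ℤ) (x : D.grading i),
      ((D.complex.d i (i + 1)) x : D.grading (i + 1)).1 = D.d x.1 := by
    intro D i x
    rw [complex_d]
    rfl
  refine quasiIso_of_moduleCat _ (fun x hx y hy => ?_) (fun y hy => ?_)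
  · obtain ⟨z, hz⟩ := hinj x.1 ((hd D _ x).symm.trans (congrArg Subtype.val hx)) y.1
      ((hd E _ y).symm.trans (congrArg Subtype.val hy))
    obtain ⟨z, hz, hzx⟩ := D.exists_homogeneous_primitive x.2 hz
    exact ⟨⟨z, hz⟩, Subtype.ext ((hd D _ ⟨z, hz⟩).trans hzx)⟩
  · obtain ⟨x, hx, hdx, hxy⟩ := hsurj (j + 1) y.1 y.2
      ((hd E _ y).symm.trans (congrArg Subtype.val hy))
    exact ⟨⟨x, hx⟩, Subtype.ext ((hd D _ ⟨x, hx⟩).trans hdx), Subtype.ext hxy⟩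

end DGAlgebra

/-! ## The retraction -/

/-! ### Matrices with row signs -/

section Twist

variable {K : Type u} [Field K] {A : Type w} [Ring A] [Algebra K A] {n : ℕ} (m : Fin n → ℤ)

/-- The sign `(-1) ^ m_i`. -/
def parity (i : Fin n) : ℤ := ((m i).negOnePow : ℤ)

theorem parity_mul_self (i : Fin n) : parity m i * parity m i = 1 :=
  Int.units_coe_mul_self _

theorem parity_smul_smul (i : Fin n) (x : A) : parity m i • parity m i • x = x := by
  rw [smul_smul, parity_mul_self, one_smul]

theorem negOnePow_add_smul (i j : Fin n) (x : A) :
    (m i + m j).negOnePow • x = parity m i • parity m j • x := by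
  rw [Units.smul_def, Int.negOnePow_add, Units.val_mul, smul_smul]
  rfl

/-- The entrywise application of a linear map, with the sign `(-1) ^ m_j` in row `j`. -/
def twist (δ : A →ₗ[K] A) : Matrix (Fin n) (Fin n) A →ₗ[K] Matrix (Fin n) (Fin n) A where
  toFun M := Matrix.of fun j i => parity m j • δ (M j i)
  map_add' M N := by ext j i; simp
  map_smul' t M := by ext j i; simp [smul_comm]

/-- The entrywise application of an algebra map, with the sign `(-1) ^ (m_i + m_j)`. -/
def conjMap (f : A →ₐ[K] A) : Matrix (Fin n) (Fin n) A →ₗ[K] Matrix (Fin n) (Fin n) A where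
  toFun M := Matrix.of fun j i => (parity m j * parity m i) • f (M j i)
  map_add' M N := by ext j i; simp
  map_smul' t M := by ext j i; simp [smul_comm]

theorem twist_apply (δ : A →ₗ[K] A) (M : Matrix (Fin n) (Fin n) A) (j i : Fin n) :
    twist m δ M j i = parity m j • δ (M j i) := rfl

theorem conjMap_apply (f : A →ₐ[K] A) (M : Matrix (Fin n) (Fin n) A) (j i : Fin n) :
    conjMap m f M j i = (parity m j * parity m i) • f (M j i) := rfl

/-- The summation index `r` enters the second term twice, once as a column sign of `M` and once as a
row sign of `N`, and `(-1)^{2 m_r} = 1`. -/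
theorem twist_mul {δ : A →ₗ[K] A} {f : A →ₐ[K] A}
    (h : ∀ x y, δ (x * y) = δ x * y + f x * δ y) (M N : Matrix (Fin n) (Fin n) A) :
    twist m δ (M * N) = twist m δ M * N + conjMap m f M * twist m δ N := by
  ext j i
  rw [twist_apply, Matrix.add_apply, Matrix.mul_apply, Matrix.mul_apply, Matrix.mul_apply, map_sum,
    Finset.smul_sum, ← Finset.sum_add_distrib]
  refine Finset.sum_congr rfl fun r _ => ?_
  rw [h, twist_apply, twist_apply, conjMap_apply, smul_add, smul_mul_assoc, smul_mul_smul_comm,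
    mul_assoc, parity_mul_self, mul_one]

theorem conjMap_mul (f : A →ₐ[K] A) (M N : Matrix (Fin n) (Fin n) A) :
    conjMap m f (M * N) = conjMap m f M * conjMap m f N := by
  ext j i
  rw [conjMap_apply, Matrix.mul_apply, Matrix.mul_apply, map_sum, Finset.smul_sum]
  refine Finset.sum_congr rfl fun r _ => ?_
  rw [map_mul, conjMap_apply, conjMap_apply, smul_mul_smul_comm]
  congr 1
  linear_combination -(parity m j * parity m i) * parity_mul_self m r

/-- The row signs square to `1`, so compositions such as `∂h` and `h∂` act on matrices entrywise
without signs. -/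
theorem twist_twist (δ ε : A →ₗ[K] A) (M : Matrix (Fin n) (Fin n) A) :
    twist m δ (twist m ε M) = M.map (δ ∘ₗ ε) := by
  ext j i
  rw [twist_apply, twist_apply, map_zsmul, parity_smul_smul]
  rfl

end Twist

section Retraction

variable {K : Type u} [Field K] {n : ℕ} {k : Type v} [Ring k] [Algebra K k]

namespace InternalAlg

/-! ### The grading sign as an automorphism -/

/-- The algebra automorphism `x ↦ (-1) ^ |x| x`. -/
def sgn (φ : CoeffMap K n k) (m : Fin n → ℤ) : InternalAlg φ →ₐ[K] InternalAlg φ :=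
  lift φ (base φ) (fun p i j => (deg m p i j).negOnePow • c φ p i j)
    (fun p i j => by rw [mul_smul_comm]; exact congrArg _ (e_mul_c φ p i j))
    (fun p i j => by rw [smul_mul_assoc]; exact congrArg _ (c_mul_e φ p i j))
    (fun i j h => by rw [c_zero φ i j h, smul_zero])

theorem sgn_base (φ : CoeffMap K n k) (m : Fin n → ℤ) (a : k) :
    sgn φ m (base φ a) = base φ a := lift_base ..

theorem sgn_c (φ : CoeffMap K n k) (m : Fin n → ℤ) (p : ℕ) (i j : Fin n) :
    sgn φ m (c φ p i j) = (deg m p i j).negOnePow • c φ p i j := lift_c ..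

theorem dMatrix_zero_zero (φ : CoeffMap K n k) (m : Fin n → ℤ) (x : InternalAlg φ) :
    dMatrix φ m x 0 0 = sgn φ m x := by
  induction x using induction with
  | hb a => rw [dMatrix_base, sgn_base]; simp
  | hc p i j => rw [dMatrix_c, sgn_c]; simp
  | hadd x y hx hy => rw [map_add, map_add, Matrix.add_apply, hx, hy]
  | hmul x y hx hy =>
    rw [map_mul, map_mul, Matrix.mul_apply, Fin.sum_univ_two, (dMatrix_lower φ m y).1, hx, hy]
    simp

/-- With the sign expressed by an automorphism the Leibniz rule needs no homogeneity, so identities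
can be proved by induction over generators, sums and products. -/
theorem d_mul_sgn (φ : CoeffMap K n k) (m : Fin n → ℤ) (x y : InternalAlg φ) :
    d φ m (x * y) = d φ m x * y + sgn φ m x * d φ m y := by
  rw [d_mul, dMatrix_zero_zero]

theorem sgn_of_mem (φ : CoeffMap K n k) (m : Fin n → ℤ) {s : ℤ} {x : InternalAlg φ}
    (hx : x ∈ grading φ m s) : sgn φ m x = s.negOnePow • x := by
  rw [← dMatrix_zero_zero, dMatrix_sign φ m hx]

theorem sgn_sgn (φ : CoeffMap K n k) (m : Fin n → ℤ) (x : InternalAlg φ) :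
    sgn φ m (sgn φ m x) = x := by
  induction x using induction with
  | hb a => rw [sgn_base, sgn_base]
  | hc p i j =>
    rw [sgn_c, Units.smul_def, map_zsmul, sgn_c, ← Units.smul_def, smul_smul,
      Int.units_mul_self, one_smul]
  | hadd x y hx hy => rw [map_add, map_add, hx, hy]
  | hmul x y hx hy => rw [map_mul, map_mul, hx, hy]

theorem sgn_d (φ : CoeffMap K n k) (m : Fin n → ℤ) (x : InternalAlg φ) :
    sgn φ m (d φ m x) = -d φ m (sgn φ m x) := by
  induction x using induction with
  | hb a => rw [sgn_base, d_base, map_zero, neg_zero]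
  | hc p i j =>
    rw [sgn_c, d_c, sgn_of_mem φ m (dGen_mem φ m p i j), Units.smul_def, Units.smul_def,
      map_zsmul, d_c, Int.negOnePow_succ]
    simp
  | hadd x y hx hy => simp only [map_add, hx, hy, neg_add]
  | hmul x y hx hy =>
    rw [d_mul_sgn, map_mul, d_mul_sgn, map_add, map_mul, map_mul, hx, hy, sgn_sgn]
    noncomm_ring

theorem d_pow_eq_zero (φ : CoeffMap K n k) (m : Fin n → ℤ) {x : InternalAlg φ}
    (hx : d φ m x = 0) (a : ℕ) : d φ m (x ^ a) = 0 := by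
  induction a with
  | zero =>
    have h := d_base φ m 1
    rwa [map_one, ← pow_zero x] at h
  | succ a ih => rw [pow_succ, d_mul_sgn, ih, hx, zero_mul, mul_zero, add_zero]

theorem d_mul_of_d_eq_zero (φ : CoeffMap K n k) (m : Fin n → ℤ) (x : InternalAlg φ)
    {y : InternalAlg φ} (hy : d φ m y = 0) :
    d φ m (x * y) = d φ m x * y := by
  rw [d_mul_sgn, hy, mul_zero, add_zero]

/-! ### The generators in matrix form -/

/-- The matrix with entry `(-1) ^ m_j c^p_{ij}` in row `j` and column `i`. -/
def cMat (φ : CoeffMap K n k) (m : Fin n → ℤ) (p : ℕ) : Matrix (Fin n) (Fin n) (InternalAlg φ) :=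
  Matrix.of fun j i => parity m j • c φ p i j

theorem cMat_apply (φ : CoeffMap K n k) (m : Fin n → ℤ) (p : ℕ) (i j : Fin n) :
    cMat φ m p j i = parity m j • c φ p i j := rfl

/-- The diagonal matrix of the idempotents. -/
def eMat (φ : CoeffMap K n k) : Matrix (Fin n) (Fin n) (InternalAlg φ) := Matrix.diagonal (e φ)

theorem eMat_mul_cMat (φ : CoeffMap K n k) (m : Fin n → ℤ) (p : ℕ) :
    eMat φ * cMat φ m p = cMat φ m p := by
  ext j i
  rw [eMat, Matrix.diagonal_mul, cMat_apply, mul_smul_comm, e_mul_c]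

theorem cMat_mul_eMat (φ : CoeffMap K n k) (m : Fin n → ℤ) (p : ℕ) :
    cMat φ m p * eMat φ = cMat φ m p := by
  ext j i
  rw [eMat, Matrix.mul_diagonal, cMat_apply, smul_mul_assoc, c_mul_e]

theorem twist_d_mul (φ : CoeffMap K n k) (m : Fin n → ℤ)
    (M N : Matrix (Fin n) (Fin n) (InternalAlg φ)) :
    twist m (d φ m) (M * N) =
      twist m (d φ m) M * N + conjMap m (sgn φ m) M * twist m (d φ m) N :=
  twist_mul m (d_mul_sgn φ m) M N

/-- The sign `(-1)^{m_r+m_j}` in the differential is the product of the row signs of the two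
factors, hence the quadratic part is a plain matrix product. -/
theorem twist_d_cMat (φ : CoeffMap K n k) (m : Fin n → ℤ) (p : ℕ) :
    twist m (d φ m) (cMat φ m p) = (if p = 1 then eMat φ else 0) +
      ∑ q ∈ Finset.HasAntidiagonal.antidiagonal p, cMat φ m q.1 * cMat φ m q.2 := by
  ext j i
  rw [twist_apply, cMat_apply, map_zsmul, parity_smul_smul, d_c, dGen, Matrix.add_apply,
    Matrix.sum_apply]
  congr 1
  · by_cases hp : p = 1
    · by_cases hij : i = j
      · simp [hp, hij, eMat]
      · simp [hp, hij, eMat, Ne.symm hij]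
    · simp [hp]
  · refine Finset.sum_congr rfl fun q _ => ?_
    rw [Matrix.mul_apply]
    refine Finset.sum_congr rfl fun r _ => ?_
    rw [cMat_apply, cMat_apply, negOnePow_add_smul, smul_mul_assoc, mul_smul_comm, smul_comm]

/-- Modulo `2` the degree of `c^p_{ij}` is `1 + m_i + m_j`; the row and column signs remove `m_i +
m_j`, leaving an odd matrix for every `p`. -/
theorem conjMap_sgn_cMat (φ : CoeffMap K n k) (m : Fin n → ℤ) (p : ℕ) :
    conjMap m (sgn φ m) (cMat φ m p) = -cMat φ m p := by
  ext j i
  have h : (deg m p i j).negOnePow = -(m i + m j).negOnePow := by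
    rw [← Int.negOnePow_succ, Int.negOnePow_eq_iff, deg]
    exact ⟨-p - m i, by ring⟩
  rw [conjMap_apply, cMat_apply, map_zsmul, sgn_c, h, Units.neg_smul, negOnePow_add_smul,
    smul_neg, smul_neg, Matrix.neg_apply, cMat_apply]
  simp only [smul_smul]
  congr 2
  linear_combination (parity m i * parity m i * parity m j) * parity_mul_self m j +
    parity m j * parity_mul_self m i

theorem conjMap_sgn_cMat_pow (φ : CoeffMap K n k) (m : Fin n → ℤ) (l : ℕ) :
    conjMap m (sgn φ m) (cMat φ m 1 ^ l) = (-1) ^ l * cMat φ m 1 ^ l := by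
  induction l with
  | zero =>
    ext j i
    rw [conjMap_apply]
    by_cases h : j = i
    · subst h
      simp [parity_mul_self]
    · simp [Matrix.one_apply_ne h]
  | succ l ih =>
    rw [pow_succ, conjMap_mul, ih, conjMap_sgn_cMat, pow_succ]
    noncomm_ring

theorem twist_d_cMat_zero (φ : CoeffMap K n k) (m : Fin n → ℤ) :
    twist m (d φ m) (cMat φ m 0) = cMat φ m 0 * cMat φ m 0 := by
  rw [twist_d_cMat, if_neg (by simp), zero_add]
  simp

theorem twist_d_cMat_one (φ : CoeffMap K n k) (m : Fin n → ℤ) :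
    twist m (d φ m) (cMat φ m 1) =
      eMat φ + cMat φ m 0 * cMat φ m 1 + cMat φ m 1 * cMat φ m 0 := by
  rw [twist_d_cMat, if_pos rfl, Finset.Nat.antidiagonal_succ]
  simp [add_assoc]

/-- In `D(M_1²) = D(M_1) M_1 - M_1 D(M_1)` the contributions of `E` cancel and a commutator with
`M_0` remains; commutators with `M_0` then propagate to powers of `M_1²`. -/
theorem twist_d_cMat_pow_even (φ : CoeffMap K n k) (m : Fin n → ℤ) (a : ℕ) :
    twist m (d φ m) (cMat φ m 1 ^ (2 * a)) =
      cMat φ m 0 * cMat φ m 1 ^ (2 * a) - cMat φ m 1 ^ (2 * a) * cMat φ m 0 := by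
  have h2 : twist m (d φ m) (cMat φ m 1 * cMat φ m 1) =
      cMat φ m 0 * (cMat φ m 1 * cMat φ m 1) - (cMat φ m 1 * cMat φ m 1) * cMat φ m 0 := by
    rw [twist_d_mul, conjMap_sgn_cMat, twist_d_cMat_one, add_mul, add_mul, eMat_mul_cMat, mul_add,
      mul_add, neg_mul, cMat_mul_eMat]
    noncomm_ring
  induction a with
  | zero =>
    ext j i
    rw [twist_apply]
    by_cases h : j = i
    · subst h
      have h1 := d_base φ m 1
      rw [map_one] at h1
      simp [h1]
    · simp [Matrix.one_apply_ne h]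
  | succ a ih =>
    rw [mul_add, mul_one, pow_add, pow_two, twist_d_mul, ih, h2, conjMap_sgn_cMat_pow, pow_mul (-1),
      neg_one_sq, one_pow, one_mul]
    noncomm_ring

/-- The last factor `M_1` contributes the extra `E`. It must be kept for `a = 0`, where the even
power is the identity matrix, which need not equal `E`. -/
theorem twist_d_cMat_pow_odd (φ : CoeffMap K n k) (m : Fin n → ℤ) (a : ℕ) :
    twist m (d φ m) (cMat φ m 1 ^ (2 * a + 1)) = cMat φ m 1 ^ (2 * a) * eMat φ +
      (cMat φ m 0 * cMat φ m 1 ^ (2 * a + 1) + cMat φ m 1 ^ (2 * a + 1) * cMat φ m 0) := by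
  rw [pow_succ, twist_d_mul, twist_d_cMat_pow_even, conjMap_sgn_cMat_pow, pow_mul (-1),
      neg_one_sq, one_pow, one_mul, twist_d_cMat_one]
  noncomm_ring

/-! ### The Catalan retraction -/

/-- The value of the retraction on the matrix of the `c^p_{ij}`. -/
def retrMat (φ : CoeffMap K n k) (m : Fin n → ℤ) (p : ℕ) :
    Matrix (Fin n) (Fin n) (InternalAlg φ) :=
  if p = 0 then cMat φ m 0 else catalan (p - 1) • cMat φ m 1 ^ (2 * (p - 1) + 1)

theorem retrMat_of_le_one (φ : CoeffMap K n k) (m : Fin n → ℤ) {p : ℕ} (hp : p ≤ 1) :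
    retrMat φ m p = cMat φ m p := by
  obtain rfl | rfl : p = 0 ∨ p = 1 := by omega
  · rfl
  · simp [retrMat]

theorem retrMat_succ (φ : CoeffMap K n k) (m : Fin n → ℤ) (p : ℕ) :
    retrMat φ m (p + 1) = catalan p • cMat φ m 1 ^ (2 * p + 1) := by
  simp [retrMat]

theorem eMat_mul_retrMat (φ : CoeffMap K n k) (m : Fin n → ℤ) (p : ℕ) :
    eMat φ * retrMat φ m p = retrMat φ m p := by
  rw [retrMat]
  split_ifs
  · exact eMat_mul_cMat φ m 0
  · rw [mul_smul_comm, pow_succ', ← mul_assoc, eMat_mul_cMat]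

theorem retrMat_mul_eMat (φ : CoeffMap K n k) (m : Fin n → ℤ) (p : ℕ) :
    retrMat φ m p * eMat φ = retrMat φ m p := by
  rw [retrMat]
  split_ifs
  · exact cMat_mul_eMat φ m 0
  · rw [smul_mul_assoc, pow_succ, mul_assoc, cMat_mul_eMat]

/-- The terms containing `R_0` account for the anticommutator with `M_0`. In the others all
exponents agree, so only `∑ C_a C_b = C_{p+1}` over `a + b = p` is needed. -/
theorem twist_d_retrMat (φ : CoeffMap K n k) (m : Fin n → ℤ) (p : ℕ) :
    twist m (d φ m) (retrMat φ m p) = (if p = 1 then eMat φ else 0) +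
      ∑ q ∈ Finset.HasAntidiagonal.antidiagonal p, retrMat φ m q.1 * retrMat φ m q.2 := by
  have h0 : retrMat φ m 0 = cMat φ m 0 := retrMat_of_le_one φ m (Nat.zero_le 1)
  rcases p with _ | _ | p
  · rw [h0, twist_d_cMat_zero]
    simp [h0]
  · have h1 : retrMat φ m 1 = cMat φ m 1 := retrMat_of_le_one φ m le_rfl
    rw [zero_add, h1, twist_d_cMat_one, Finset.Nat.antidiagonal_succ]
    simp [h0, h1, add_assoc]
  · have hE : cMat φ m 1 ^ (2 * (p + 1)) * eMat φ = cMat φ m 1 ^ (2 * (p + 1)) := by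
      rw [mul_add, mul_one, pow_succ, mul_assoc, cMat_mul_eMat]
    have hsum : ∑ q ∈ Finset.HasAntidiagonal.antidiagonal p,
        retrMat φ m (q.1 + 1) * retrMat φ m (q.2 + 1) =
        catalan (p + 1) • cMat φ m 1 ^ (2 * (p + 1)) := by
      rw [catalan_succ', Finset.sum_smul]
      refine Finset.sum_congr rfl fun q hq => ?_
      rw [retrMat_succ, retrMat_succ, smul_mul_smul_comm, ← pow_add,
        ← Finset.HasAntidiagonal.mem_antidiagonal.1 hq]
      congr 2
      ring
    rw [if_neg (by omega), zero_add, Finset.Nat.antidiagonal_succ_succ', Finset.sum_cons,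
      Finset.sum_cons, Finset.sum_map, h0]
    simp only [Function.Embedding.prodMap, Function.Embedding.coeFn_mk, Prod.map,
      Nat.succ_eq_add_one]
    rw [hsum, retrMat_succ, map_nsmul, twist_d_cMat_pow_odd, hE, smul_add, smul_add,
      mul_smul_comm, smul_mul_assoc]
    abel

/-- The retraction of `I_n^k` onto `A_n^k`, as an algebra endomorphism of `I_n^k`. -/
def retr (φ : CoeffMap K n k) (m : Fin n → ℤ) : InternalAlg φ →ₐ[K] InternalAlg φ :=
  lift φ (base φ) (fun p i j => parity m j • retrMat φ m p j i)
    (fun p i j => by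
      have h := congrFun (congrFun (eMat_mul_retrMat φ m p) j) i
      rw [eMat, Matrix.diagonal_mul] at h
      rw [mul_smul_comm]
      exact congrArg _ h)
    (fun p i j => by
      have h := congrFun (congrFun (retrMat_mul_eMat φ m p) j) i
      rw [eMat, Matrix.mul_diagonal] at h
      rw [smul_mul_assoc]
      exact congrArg _ h)
    (fun i j h => by
      rw [retrMat_of_le_one φ m (Nat.zero_le 1), cMat_apply, parity_smul_smul, c_zero φ i j h])

theorem retr_base (φ : CoeffMap K n k) (m : Fin n → ℤ) (a : k) :
    retr φ m (base φ a) = base φ a := lift_base ..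

theorem retr_c (φ : CoeffMap K n k) (m : Fin n → ℤ) (p : ℕ) (i j : Fin n) :
    retr φ m (c φ p i j) = parity m j • retrMat φ m p j i := lift_c ..

theorem retr_c_of_le_one (φ : CoeffMap K n k) (m : Fin n → ℤ) {p : ℕ} (hp : p ≤ 1)
    (i j : Fin n) : retr φ m (c φ p i j) = c φ p i j := by
  rw [retr_c, retrMat_of_le_one φ m hp, cMat_apply, parity_smul_smul]

theorem map_retr_cMat (φ : CoeffMap K n k) (m : Fin n → ℤ) (p : ℕ) :
    (cMat φ m p).map (retr φ m) = retrMat φ m p := by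
  ext j i
  rw [Matrix.map_apply, cMat_apply, map_zsmul, retr_c, parity_smul_smul]

theorem map_retr_eMat (φ : CoeffMap K n k) (m : Fin n → ℤ) :
    (eMat φ).map (retr φ m) = eMat φ := by
  rw [eMat, Matrix.diagonal_map (map_zero _)]
  congr 1
  ext i
  exact retr_base φ m _

/-- The matrices `M_p` and their images `R_p` obey the same structure equation, whose right side is
preserved by any algebra map fixing `E`. This is the chain map property on generators. -/
theorem map_retr_twist_d_cMat (φ : CoeffMap K n k) (m : Fin n → ℤ) (p : ℕ) :
    (twist m (d φ m) (cMat φ m p)).map (retr φ m) = twist m (d φ m) (retrMat φ m p) := by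
  have h : ∀ M : Matrix (Fin n) (Fin n) (InternalAlg φ),
      M.map (retr φ m) = (retr φ m).mapMatrix M := fun _ => rfl
  rw [twist_d_retrMat, twist_d_cMat, h, map_add, map_sum]
  congr 1
  · split_ifs
    · exact map_retr_eMat φ m
    · exact map_zero _
  · refine Finset.sum_congr rfl fun q _ => ?_
    rw [map_mul, ← h, ← h, map_retr_cMat, map_retr_cMat]

theorem cMat_pow_mem (φ : CoeffMap K n k) (m : Fin n → ℤ) (l : ℕ) (i j : Fin n) :
    (cMat φ m 1 ^ (l + 1)) j i ∈ grading φ m (m j - m i - (l + 1)) := by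
  induction l generalizing i with
  | zero =>
    rw [zero_add, pow_one, cMat_apply]
    refine zsmul_mem ?_ _
    convert c_mem φ m 1 i j using 2
    rw [deg]
    push_cast
    ring
  | succ l ih =>
    rw [pow_succ, Matrix.mul_apply]
    refine sum_mem fun r _ => ?_
    rw [cMat_apply]
    convert (gradedMonoid φ m).mul_mem (ih r) (zsmul_mem (c_mem φ m 1 i r) (parity m r)) using 2
    rw [deg]
    push_cast
    ring

theorem retr_c_mem (φ : CoeffMap K n k) (m : Fin n → ℤ) (p : ℕ) (i j : Fin n) :
    retr φ m (c φ p i j) ∈ grading φ m (deg m p i j) := by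
  rcases p with _ | p
  · rw [retr_c_of_le_one φ m (Nat.zero_le 1)]
    exact c_mem φ m 0 i j
  · rw [retr_c, retrMat_succ, Matrix.smul_apply]
    refine zsmul_mem (nsmul_mem ?_ _) _
    convert cMat_pow_mem φ m (2 * p) i j using 2
    rw [deg]
    push_cast
    ring

theorem retr_mem (φ : CoeffMap K n k) (m : Fin n → ℤ) {s : ℤ} {x : InternalAlg φ}
    (hx : x ∈ grading φ m s) : retr φ m x ∈ grading φ m s := by
  induction hx using Submodule.span_induction with
  | mem x hx =>
    induction hx with
    | base a => rw [retr_base]; exact base_mem φ m a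
    | gen p i j => exact retr_c_mem φ m p i j
    | mul _ _ h1 h2 => rw [map_mul]; exact (gradedMonoid φ m).mul_mem h1 h2
  | zero => rw [map_zero]; exact zero_mem _
  | add x y _ _ h1 h2 => rw [map_add]; exact add_mem h1 h2
  | smul t x _ h => rw [map_smul]; exact Submodule.smul_mem _ t h

theorem sgn_retr (φ : CoeffMap K n k) (m : Fin n → ℤ) (x : InternalAlg φ) :
    sgn φ m (retr φ m x) = retr φ m (sgn φ m x) := by
  induction x using induction with
  | hb a => rw [sgn_base, retr_base, sgn_base]
  | hc p i j =>
    rw [sgn_of_mem φ m (retr_c_mem φ m p i j), sgn_c, Units.smul_def, Units.smul_def, map_zsmul]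
  | hadd x y hx hy => simp only [map_add, hx, hy]
  | hmul x y hx hy => simp only [map_mul, hx, hy]

theorem retr_d (φ : CoeffMap K n k) (m : Fin n → ℤ) (x : InternalAlg φ) :
    retr φ m (d φ m x) = d φ m (retr φ m x) := by
  induction x using induction with
  | hb a => rw [d_base, retr_base, d_base, map_zero]
  | hc p i j =>
    have h := congrFun (congrFun (map_retr_twist_d_cMat φ m p) j) i
    rw [Matrix.map_apply, twist_apply, twist_apply, cMat_apply, map_zsmul, map_zsmul, map_zsmul,
      parity_smul_smul] at h
    rw [h, retr_c, map_zsmul]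
  | hadd x y hx hy => simp only [map_add, hx, hy]
  | hmul x y hx hy =>
    rw [d_mul_sgn, map_mul, d_mul_sgn, map_add, map_mul, map_mul, hx, hy, sgn_retr]

theorem cMat_pow_mem_small (φ : CoeffMap K n k) (m : Fin n → ℤ) (l : ℕ) (i j : Fin n) :
    (cMat φ m 1 ^ l) j i ∈ small φ := by
  induction l generalizing i with
  | zero =>
    rw [pow_zero, Matrix.one_apply]
    split_ifs
    · exact one_mem _
    · exact zero_mem _
  | succ l ih =>
    rw [pow_succ, Matrix.mul_apply]
    exact sum_mem fun r _ => mul_mem (ih r) (zsmul_mem (c_mem_small φ le_rfl i r) _)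

theorem retr_mem_small (φ : CoeffMap K n k) (m : Fin n → ℤ) (x : InternalAlg φ) :
    retr φ m x ∈ small φ := by
  induction x using induction with
  | hb a => rw [retr_base]; exact base_mem_small φ a
  | hc p i j =>
    rcases p with _ | p
    · rw [retr_c_of_le_one φ m (Nat.zero_le 1)]
      exact c_mem_small φ (Nat.zero_le 1) i j
    · rw [retr_c, retrMat_succ, Matrix.smul_apply]
      exact zsmul_mem (nsmul_mem (cMat_pow_mem_small φ m _ i j) _) _
  | hadd x y hx hy => rw [map_add]; exact add_mem hx hy
  | hmul x y hx hy => rw [map_mul]; exact mul_mem hx hy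

theorem retr_of_mem_small (φ : CoeffMap K n k) (m : Fin n → ℤ) {x : InternalAlg φ}
    (hx : x ∈ small φ) : retr φ m x = x := by
  induction hx using Algebra.adjoin_induction with
  | mem x hx =>
    rcases hx with ⟨a, rfl⟩ | ⟨p, i, j, hp, rfl⟩
    · exact retr_base φ m a
    · exact retr_c_of_le_one φ m hp i j
  | algebraMap t => exact AlgHom.commutes _ t
  | add x y _ _ h1 h2 => rw [map_add, h1, h2]
  | mul x y _ _ h1 h2 => rw [map_mul, h1, h2]

/-- Each entry of the power is a sum over paths from `i` to `j`. Every intermediate vertex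
contributes its row sign once, and the sign of the endpoint `j` stays outside. -/
theorem cMat_pow_apply (φ : CoeffMap K n k) (m : Fin n → ℤ) (l : ℕ) (i j : Fin n) :
    (cMat φ m 1 ^ (l + 1)) j i = parity m j • ∑ κ : Fin l → Fin n,
      (∑ t, m (κ t)).negOnePow • pathWord φ j i (List.ofFn κ) := by
  induction l generalizing i with
  | zero => simp [cMat_apply, pathWord]
  | succ l ih =>
    -- The new factor goes on the right: it is the first step of the path, which is also where
    -- `pathWord` peels off a letter.
    rw [pow_succ, Matrix.mul_apply, ← (Fin.consEquiv fun _ => Fin n).sum_comp,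
      Fintype.sum_prod_type, Finset.smul_sum]
    refine Finset.sum_congr rfl fun r _ => ?_
    rw [ih, cMat_apply, smul_mul_assoc, Finset.sum_mul]
    congr 1
    refine Finset.sum_congr rfl fun κ _ => ?_
    simp only [Fin.consEquiv_apply, Fin.sum_univ_succ, Fin.cons_zero, Fin.cons_succ,
      List.ofFn_succ, pathWord, Int.negOnePow_add, Units.smul_def, Units.val_mul]
    rw [smul_mul_smul_comm, mul_comm, parity]

end InternalAlg

/-- The retraction `I_n^k → A_n^k`. -/
def retraction (φ : CoeffMap K n k) (m : Fin n → ℤ) : (internalDG φ m).Hom (smallDG φ m) where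
  toAlgHom := (InternalAlg.retr φ m).codRestrict (InternalAlg.small φ)
    (InternalAlg.retr_mem_small φ m)
  map_mem _ _ hx := InternalAlg.retr_mem φ m hx
  comm x := Subtype.ext (InternalAlg.retr_d φ m x)

theorem isRetraction_retraction (φ : CoeffMap K n k) (m : Fin n → ℤ) :
    IsRetraction φ m (retraction φ m) := by
  refine ⟨fun x => Subtype.ext (InternalAlg.retr_of_mem_small φ m x.2), fun p i j hp => ?_⟩
  obtain ⟨p, rfl⟩ : ∃ q, p = q + 1 := ⟨p - 1, by omega⟩
  refine (InternalAlg.retr_c φ m (p + 1) i j).trans ?_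
  rw [InternalAlg.retrMat_succ, Matrix.smul_apply, InternalAlg.cMat_pow_apply, smul_comm,
    parity_smul_smul]
  rfl

/-! ## The homotopy -/

namespace InternalAlg

/-- The value of the homotopy on the matrix of the `c^p_{ij}`. -/
def homotMat (φ : CoeffMap K n k) (m : Fin n → ℤ) (p : ℕ) :
    Matrix (Fin n) (Fin n) (InternalAlg φ) :=
  if p ≤ 1 then 0 else cMat φ m 1 * cMat φ m p

theorem eMat_mul_homotMat (φ : CoeffMap K n k) (m : Fin n → ℤ) (p : ℕ) :
    eMat φ * homotMat φ m p = homotMat φ m p := by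
  rw [homotMat]
  split_ifs
  · exact mul_zero _
  · rw [← mul_assoc, eMat_mul_cMat]

theorem homotMat_mul_eMat (φ : CoeffMap K n k) (m : Fin n → ℤ) (p : ℕ) :
    homotMat φ m p * eMat φ = homotMat φ m p := by
  rw [homotMat]
  split_ifs
  · exact zero_mul _
  · rw [mul_assoc, cMat_mul_eMat]

/-- The algebra map `x ↦ ((σ r x, h x), (0, x))`, where `σ x = (-1) ^ |x| x`, `r` is the retraction
and `h` is the homotopy. -/
def homotMatrix (φ : CoeffMap K n k) (m : Fin n → ℤ) :
    InternalAlg φ →ₐ[K] Matrix (Fin 2) (Fin 2) (InternalAlg φ) :=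
  lift φ ((Matrix.scalarAlgHom (Fin 2) K).comp (base φ))
    (fun p i j => !![sgn φ m (retr φ m (c φ p i j)), homotMat φ m p j i; 0, c φ p i j])
    (fun p i j => by
      have h0 := e_mul_c φ p i j
      have h1 := congrArg (fun x => sgn φ m (retr φ m x)) h0
      have h2 := congrFun (congrFun (eMat_mul_homotMat φ m p) j) i
      rw [eMat, Matrix.diagonal_mul] at h2
      simp only [e, map_mul, retr_base, sgn_base] at h0 h1 h2
      ext a b
      fin_cases a <;> fin_cases b <;>
        simp [Matrix.mul_apply, Matrix.scalar_apply, Matrix.diagonal, h0, h1, h2])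
    (fun p i j => by
      have h0 := c_mul_e φ p i j
      have h1 := congrArg (fun x => sgn φ m (retr φ m x)) h0
      have h2 := congrFun (congrFun (homotMat_mul_eMat φ m p) j) i
      rw [eMat, Matrix.mul_diagonal] at h2
      simp only [e, map_mul, retr_base, sgn_base] at h0 h1 h2
      ext a b
      fin_cases a <;> fin_cases b <;>
        simp [Matrix.mul_apply, Matrix.scalar_apply, Matrix.diagonal, h0, h1, h2])
    (fun i j h => by
      rw [c_zero φ i j h]
      ext a b
      fin_cases a <;> fin_cases b <;> simp [homotMat])

/-- The homotopy between the identity and the retraction, up to terms of lower weight. -/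
def homot (φ : CoeffMap K n k) (m : Fin n → ℤ) : InternalAlg φ →ₗ[K] InternalAlg φ :=
  (Matrix.entryLinearMap K (InternalAlg φ) (0 : Fin 2) (1 : Fin 2)).comp
    (homotMatrix φ m).toLinearMap

theorem homot_apply (φ : CoeffMap K n k) (m : Fin n → ℤ) (x : InternalAlg φ) :
    homot φ m x = homotMatrix φ m x 0 1 := rfl

theorem homotMatrix_base (φ : CoeffMap K n k) (m : Fin n → ℤ) (a : k) :
    homotMatrix φ m (base φ a) = Matrix.scalar (Fin 2) (base φ a) := lift_base ..

theorem homotMatrix_c (φ : CoeffMap K n k) (m : Fin n → ℤ) (p : ℕ) (i j : Fin n) :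
    homotMatrix φ m (c φ p i j) =
      !![sgn φ m (retr φ m (c φ p i j)), homotMat φ m p j i; 0, c φ p i j] := lift_c ..

theorem homotMatrix_diag (φ : CoeffMap K n k) (m : Fin n → ℤ) (x : InternalAlg φ) :
    homotMatrix φ m x 0 0 = sgn φ m (retr φ m x) ∧ homotMatrix φ m x 1 0 = 0 ∧
      homotMatrix φ m x 1 1 = x := by
  induction x using induction with
  | hb a => rw [homotMatrix_base, retr_base, sgn_base]; simp
  | hc p i j => rw [homotMatrix_c]; simp
  | hadd x y hx hy => simp [hx, hy]
  | hmul x y hx hy => simp [Matrix.mul_apply, Fin.sum_univ_two, hx, hy]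

theorem homot_base (φ : CoeffMap K n k) (m : Fin n → ℤ) (a : k) : homot φ m (base φ a) = 0 := by
  rw [homot_apply, homotMatrix_base]
  simp

theorem homot_c (φ : CoeffMap K n k) (m : Fin n → ℤ) (p : ℕ) (i j : Fin n) :
    homot φ m (c φ p i j) = homotMat φ m p j i := by
  rw [homot_apply, homotMatrix_c]
  simp

/-- Letters to the left of the place where the homotopy acts are retracted, those to its right are
left alone, as in the standard homotopy on a tensor algebra. -/
theorem homot_mul (φ : CoeffMap K n k) (m : Fin n → ℤ) (x y : InternalAlg φ) :
    homot φ m (x * y) = homot φ m x * y + sgn φ m (retr φ m x) * homot φ m y := by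
  rw [homot_apply, map_mul, Matrix.mul_apply, Fin.sum_univ_two, (homotMatrix_diag φ m y).2.2,
    (homotMatrix_diag φ m x).1, add_comm]
  rfl

theorem homotMat_mem (φ : CoeffMap K n k) (m : Fin n → ℤ) (p : ℕ) (i j : Fin n) :
    homotMat φ m p j i ∈ grading φ m (deg m p i j - 1) := by
  rw [homotMat]
  split_ifs
  · exact zero_mem _
  · rw [Matrix.mul_apply]
    refine sum_mem fun r _ => ?_
    have h : deg m p i j - 1 = deg m 1 r j + deg m p i r := by
      simp only [deg]
      push_cast
      ring
    rw [h]
    exact (gradedMonoid φ m).mul_mem (zsmul_mem (c_mem φ m 1 r j) _) (zsmul_mem (c_mem φ m p i r) _)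

theorem sgn_homot (φ : CoeffMap K n k) (m : Fin n → ℤ) (x : InternalAlg φ) :
    sgn φ m (homot φ m x) = -homot φ m (sgn φ m x) := by
  induction x using induction with
  | hb a => rw [sgn_base, homot_base, map_zero, neg_zero]
  | hc p i j =>
    rw [sgn_c, homot_c, sgn_of_mem φ m (homotMat_mem φ m p i j), Units.smul_def, Units.smul_def,
      map_zsmul, homot_c, Int.negOnePow_sub, Int.negOnePow_one]
    simp
  | hadd x y hx hy => simp only [map_add, hx, hy, neg_add]
  | hmul x y hx hy =>
    rw [homot_mul, map_mul, homot_mul, map_add, map_mul, map_mul, hx, hy, sgn_sgn, sgn_retr,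
      sgn_sgn]
    noncomm_ring

/-! ### The error of the homotopy -/

/-- The difference of `1 - r` and `∂ h + h ∂`. -/
def defect (φ : CoeffMap K n k) (m : Fin n → ℤ) : InternalAlg φ →ₗ[K] InternalAlg φ :=
  LinearMap.id - (retr φ m).toLinearMap - (d φ m ∘ₗ homot φ m + homot φ m ∘ₗ d φ m)

theorem defect_apply (φ : CoeffMap K n k) (m : Fin n → ℤ) (x : InternalAlg φ) :
    defect φ m x = x - retr φ m x - (d φ m (homot φ m x) + homot φ m (d φ m x)) := rfl

/-- Both `1 - r` and `∂h + h∂` are derivations relative to `r` on the left and the identity on the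
right; the mixed terms of the latter cancel because `∂` and `h` are odd. -/
theorem defect_mul (φ : CoeffMap K n k) (m : Fin n → ℤ) (x y : InternalAlg φ) :
    defect φ m (x * y) = defect φ m x * y + retr φ m x * defect φ m y := by
  simp only [defect_apply, homot_mul, d_mul_sgn, map_add, map_mul, sgn_sgn, sgn_homot, ← sgn_retr,
    retr_d, sgn_d]
  noncomm_ring

theorem d_defect (φ : CoeffMap K n k) (m : Fin n → ℤ) (x : InternalAlg φ) :
    d φ m (defect φ m x) = defect φ m (d φ m x) := by
  simp only [defect_apply, map_sub, map_add, d_d, retr_d, map_zero, zero_add, add_zero]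

theorem defect_base (φ : CoeffMap K n k) (m : Fin n → ℤ) (a : k) :
    defect φ m (base φ a) = 0 := by
  simp [defect_apply, retr_base, d_base, homot_base]

theorem twist_homot_cMat (φ : CoeffMap K n k) (m : Fin n → ℤ) (p : ℕ) :
    twist m (homot φ m) (cMat φ m p) = homotMat φ m p := by
  ext j i
  rw [twist_apply, cMat_apply, map_zsmul, parity_smul_smul, homot_c]

theorem twist_homot_eMat (φ : CoeffMap K n k) (m : Fin n → ℤ) :
    twist m (homot φ m) (eMat φ) = 0 := by
  ext j i
  rw [twist_apply, eMat, Matrix.diagonal_apply]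
  split_ifs
  · rw [e, homot_base, smul_zero, Matrix.zero_apply]
  · rw [map_zero, smul_zero, Matrix.zero_apply]

theorem conjMap_sgn_retr_cMat (φ : CoeffMap K n k) (m : Fin n → ℤ) (p : ℕ) :
    conjMap m ((sgn φ m).comp (retr φ m)) (cMat φ m p) = -retrMat φ m p := by
  have h : conjMap m ((sgn φ m).comp (retr φ m)) (cMat φ m p) =
      (conjMap m (sgn φ m) (cMat φ m p)).map (retr φ m) := by
    ext j i
    rw [conjMap_apply, Matrix.map_apply, conjMap_apply, map_zsmul, ← sgn_retr]
    rfl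
  rw [h, conjMap_sgn_cMat, ← map_retr_cMat]
  ext j i
  exact map_neg (retr φ m) _

theorem twist_homot_cMat_mul (φ : CoeffMap K n k) (m : Fin n → ℤ) (p q : ℕ) :
    twist m (homot φ m) (cMat φ m p * cMat φ m q) =
      homotMat φ m p * cMat φ m q - retrMat φ m p * homotMat φ m q := by
  rw [twist_mul m (f := (sgn φ m).comp (retr φ m)) (homot_mul φ m), twist_homot_cMat,
    twist_homot_cMat, conjMap_sgn_retr_cMat, neg_mul, sub_eq_add_neg]

theorem map_defect_cMat (φ : CoeffMap K n k) (m : Fin n → ℤ) (p : ℕ) :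
    (cMat φ m p).map (defect φ m) = cMat φ m p - retrMat φ m p -
      (twist m (d φ m) (homotMat φ m p) +
        twist m (homot φ m) (twist m (d φ m) (cMat φ m p))) := by
  rw [← twist_homot_cMat, twist_twist, twist_twist, ← map_retr_cMat]
  rfl

/-- All generators occurring in these differentials have upper index at most `1`, so the homotopy
kills every term, and `r` is the identity there. -/
theorem defect_c_of_le_one (φ : CoeffMap K n k) (m : Fin n → ℤ) {p : ℕ} (hp : p ≤ 1)
    (i j : Fin n) : defect φ m (c φ p i j) = 0 := by
  have h0 : ∀ p ≤ 1, homotMat φ m p = 0 := fun p hp => if_pos hp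
  have hsum : twist m (homot φ m) (twist m (d φ m) (cMat φ m p)) = 0 := by
    rw [twist_d_cMat, map_add, map_sum]
    have h1 : twist m (homot φ m) (if p = 1 then eMat φ else 0) = 0 := by
      split_ifs
      · exact twist_homot_eMat φ m
      · exact map_zero _
    rw [h1, zero_add]
    refine Finset.sum_eq_zero fun q hq => ?_
    have := Finset.HasAntidiagonal.mem_antidiagonal.1 hq
    rw [twist_homot_cMat_mul, h0 _ (by omega), h0 _ (by omega), zero_mul, mul_zero, sub_zero]
  have h := congrFun (congrFun (map_defect_cMat φ m p) j) i
  rw [hsum, h0 p hp, retrMat_of_le_one φ m hp, map_zero, sub_self, add_zero, sub_zero,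
    Matrix.map_apply, cMat_apply, map_zsmul] at h
  rw [← parity_smul_smul m j (defect φ m _), h, Matrix.zero_apply, smul_zero]

/-- The summand `E` of `D M_1` reproduces `M_{q+2}` in `D(M_1 M_{q+2})`, and the terms with `M_0`
cancel against the homotopy applied to the two extreme terms of `D M_{q+2}`. What is left involves
`R_{q+2}` and products whose upper indices are smaller. -/
theorem map_defect_cMat_add_two (φ : CoeffMap K n k) (m : Fin n → ℤ) (q : ℕ) :
    (cMat φ m (q + 2)).map (defect φ m) =
      ∑ a ∈ Finset.HasAntidiagonal.antidiagonal q,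
        (cMat φ m 1 * (cMat φ m (a.1 + 1) * cMat φ m (a.2 + 1)) -
          (homotMat φ m (a.1 + 1) * cMat φ m (a.2 + 1) -
            retrMat φ m (a.1 + 1) * homotMat φ m (a.2 + 1))) - retrMat φ m (q + 2) := by
  have h0 : homotMat φ m 0 = 0 := if_pos (Nat.zero_le 1)
  have hq : homotMat φ m (q + 2) = cMat φ m 1 * cMat φ m (q + 2) := if_neg (by omega)
  have hd : twist m (d φ m) (cMat φ m (q + 2)) = cMat φ m 0 * cMat φ m (q + 2) +
      (cMat φ m (q + 2) * cMat φ m 0 + ∑ a ∈ Finset.HasAntidiagonal.antidiagonal q,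
        cMat φ m (a.1 + 1) * cMat φ m (a.2 + 1)) := by
    rw [twist_d_cMat, if_neg (by omega), zero_add, Finset.Nat.antidiagonal_succ_succ',
      Finset.sum_cons, Finset.sum_cons, Finset.sum_map]
    rfl
  rw [map_defect_cMat, hq, twist_d_mul, conjMap_sgn_cMat, hd, map_add, map_add, map_sum,
    twist_homot_cMat_mul, twist_homot_cMat_mul, hq, h0, twist_d_cMat_one, add_mul, add_mul,
    eMat_mul_cMat, retrMat_of_le_one φ m (Nat.zero_le 1), Finset.sum_sub_distrib,
    ← Finset.mul_sum]
  simp only [twist_homot_cMat_mul]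
  noncomm_ring

/-! ### The weight filtration and the induction -/

/-- The elements of weight at most `w`, where `c^p_{ij}` has weight `p - 1` for `p ≥ 1` and
`c^0_{ij}` has weight `0`. -/
inductive HasWeight (φ : CoeffMap K n k) : ℕ → InternalAlg φ → Prop
  | base (a : k) : HasWeight φ 0 (base φ a)
  | gen (p : ℕ) (i j : Fin n) : HasWeight φ (p - 1) (c φ p i j)
  | add {w : ℕ} {x y : InternalAlg φ} (hx : HasWeight φ w x) (hy : HasWeight φ w y) :
      HasWeight φ w (x + y)
  | mul {s t : ℕ} {x y : InternalAlg φ} (hx : HasWeight φ s x) (hy : HasWeight φ t y) :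
      HasWeight φ (s + t) (x * y)
  | mono {s t : ℕ} {x : InternalAlg φ} (h : s ≤ t) (hx : HasWeight φ s x) : HasWeight φ t x

/-- The subspace of elements of weight at most `w`. -/
def weight (φ : CoeffMap K n k) (w : ℕ) : Submodule K (InternalAlg φ) where
  carrier := {x | HasWeight φ w x}
  add_mem' := HasWeight.add
  zero_mem' := by
    have h := HasWeight.base (φ := φ) 0
    rw [map_zero] at h
    exact h.mono (Nat.zero_le w)
  smul_mem' t x hx := by
    have h := (HasWeight.base (φ := φ) (algebraMap K k t)).mul hx
    rwa [zero_add, AlgHom.commutes, ← Algebra.smul_def] at h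

theorem weight_mono (φ : CoeffMap K n k) {s t : ℕ} (h : s ≤ t) : weight φ s ≤ weight φ t :=
  fun _ hx => HasWeight.mono h hx

theorem exists_mem_weight (φ : CoeffMap K n k) (x : InternalAlg φ) : ∃ w, x ∈ weight φ w := by
  induction x using induction with
  | hb a => exact ⟨0, HasWeight.base a⟩
  | hc p i j => exact ⟨p - 1, HasWeight.gen p i j⟩
  | hadd x y hx hy =>
    obtain ⟨s, hs⟩ := hx
    obtain ⟨t, ht⟩ := hy
    exact ⟨s + t, add_mem (weight_mono φ (Nat.le_add_right s t) hs)
      (weight_mono φ (Nat.le_add_left t s) ht)⟩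
  | hmul x y hx hy =>
    obtain ⟨s, hs⟩ := hx
    obtain ⟨t, ht⟩ := hy
    exact ⟨s + t, HasWeight.mul hs ht⟩

theorem mul_apply_mem_weight (φ : CoeffMap K n k) {s t w : ℕ} (hw : s + t ≤ w)
    {M N : Matrix (Fin n) (Fin n) (InternalAlg φ)} (hM : ∀ j i, M j i ∈ weight φ s)
    (hN : ∀ j i, N j i ∈ weight φ t) (j i : Fin n) : (M * N) j i ∈ weight φ w := by
  rw [Matrix.mul_apply]
  exact sum_mem fun r _ => weight_mono φ hw (HasWeight.mul (hM j r) (hN r i))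

theorem cMat_mem_weight (φ : CoeffMap K n k) (m : Fin n → ℤ) (p : ℕ) (j i : Fin n) :
    cMat φ m p j i ∈ weight φ (p - 1) :=
  zsmul_mem (show c φ p i j ∈ weight φ (p - 1) from HasWeight.gen p i j) _

theorem homotMat_mem_weight (φ : CoeffMap K n k) (m : Fin n → ℤ) (p : ℕ) (j i : Fin n) :
    homotMat φ m p j i ∈ weight φ (p - 1) := by
  rw [homotMat]
  split_ifs
  · exact zero_mem _
  · exact mul_apply_mem_weight φ (zero_add _).le (cMat_mem_weight φ m 1) (cMat_mem_weight φ m p) j i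

theorem mem_weight_zero_of_mem_small (φ : CoeffMap K n k) {x : InternalAlg φ}
    (hx : x ∈ small φ) : x ∈ weight φ 0 := by
  induction hx using Algebra.adjoin_induction with
  | mem x hx =>
    rcases hx with ⟨a, rfl⟩ | ⟨p, i, j, hp, rfl⟩
    · exact HasWeight.base a
    · have h := HasWeight.gen (φ := φ) p i j
      rwa [Nat.sub_eq_zero_of_le hp] at h
  | algebraMap t =>
    have h := HasWeight.base (φ := φ) (algebraMap K k t)
    rwa [AlgHom.commutes] at h
  | add x y _ _ h1 h2 => exact add_mem h1 h2
  | mul x y _ _ h1 h2 => exact HasWeight.mul h1 h2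

theorem retrMat_mem_weight (φ : CoeffMap K n k) (m : Fin n → ℤ) (p : ℕ) (j i : Fin n) :
    retrMat φ m p j i ∈ weight φ 0 := by
  rw [← map_retr_cMat, Matrix.map_apply]
  exact mem_weight_zero_of_mem_small φ (retr_mem_small φ m _)

/-- Factors with upper indices `a + 1` and `b + 1`, `a + b = q`, have total weight `q`, one less
than the weight `q + 1` of the generator; `M_1` and the retracted matrices weigh nothing. -/
theorem defect_c_mem_weight (φ : CoeffMap K n k) (m : Fin n → ℤ) (q : ℕ) (i j : Fin n) :
    defect φ m (c φ (q + 2) i j) ∈ weight φ q := by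
  have h := congrFun (congrFun (map_defect_cMat_add_two φ m q) j) i
  rw [Matrix.map_apply, cMat_apply, map_zsmul] at h
  rw [← parity_smul_smul m j (defect φ m _), h, Matrix.sub_apply, Matrix.sum_apply]
  refine zsmul_mem (sub_mem (sum_mem fun a ha => ?_)
    (weight_mono φ (Nat.zero_le q) (retrMat_mem_weight φ m _ j i))) _
  have ha := Finset.HasAntidiagonal.mem_antidiagonal.1 ha
  rw [Matrix.sub_apply, Matrix.sub_apply]
  refine sub_mem ?_ (sub_mem ?_ ?_)
  · exact mul_apply_mem_weight φ (by omega) (cMat_mem_weight φ m 1)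
      (mul_apply_mem_weight φ le_rfl (cMat_mem_weight φ m _) (cMat_mem_weight φ m _)) j i
  · exact mul_apply_mem_weight φ (by omega) (homotMat_mem_weight φ m _) (cMat_mem_weight φ m _) j i
  · exact mul_apply_mem_weight φ (by omega) (retrMat_mem_weight φ m _)
      (homotMat_mem_weight φ m _) j i

/-- The separate clause for `w = 0` is needed because the truncated `w - 1` does not drop there. It
also serves the product case, where a factor of weight `0` has no error. -/
theorem defect_mem_weight (φ : CoeffMap K n k) (m : Fin n → ℤ) {w : ℕ} {x : InternalAlg φ}
    (hx : x ∈ weight φ w) :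
    defect φ m x ∈ weight φ (w - 1) ∧ (w = 0 → defect φ m x = 0) := by
  change HasWeight φ w x at hx
  induction hx with
  | base a => rw [defect_base]; exact ⟨zero_mem _, fun _ => rfl⟩
  | gen p i j =>
    by_cases hp : p ≤ 1
    · rw [defect_c_of_le_one φ m hp]
      exact ⟨zero_mem _, fun _ => rfl⟩
    · obtain ⟨q, rfl⟩ : ∃ q, p = q + 2 := ⟨p - 2, by omega⟩
      exact ⟨defect_c_mem_weight φ m q i j, fun h => by omega⟩
  | add _ _ h1 h2 =>
    rw [map_add]
    exact ⟨add_mem h1.1 h2.1, fun h => by rw [h1.2 h, h2.2 h, add_zero]⟩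
  | @mul s t x y hx hy h1 h2 =>
    rw [defect_mul]
    refine ⟨add_mem ?_ ?_, fun h => ?_⟩
    · rcases Nat.eq_zero_or_pos s with hs | hs
      · rw [h1.2 hs, zero_mul]
        exact zero_mem _
      · exact weight_mono φ (by omega) (HasWeight.mul h1.1 hy)
    · rcases Nat.eq_zero_or_pos t with ht | ht
      · rw [h2.2 ht, mul_zero]
        exact zero_mem _
      · exact weight_mono φ (by omega)
          (HasWeight.mul (mem_weight_zero_of_mem_small φ (retr_mem_small φ m x)) h2.1)
    · rw [h1.2 (by omega), h2.2 (by omega), zero_mul, mul_zero, add_zero]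
  | mono h _ h1 =>
    exact ⟨weight_mono φ (by omega) h1.1, fun h' => h1.2 (by omega)⟩

/-- A cocycle `x` is `r x + ∂(h x)` plus its error, which is a cocycle of smaller weight and falls
under the induction hypothesis. -/
theorem exists_d_eq_sub_retr (φ : CoeffMap K n k) (m : Fin n → ℤ) (x : InternalAlg φ)
    (hx : d φ m x = 0) : ∃ y, d φ m y = x - retr φ m x := by
  obtain ⟨w, hw⟩ := exists_mem_weight φ x
  induction w generalizing x with
  | zero =>
    have h := (defect_mem_weight φ m hw).2 rfl
    rw [defect_apply, hx, map_zero, add_zero, sub_eq_zero] at h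
    exact ⟨_, h.symm⟩
  | succ w ih =>
    obtain ⟨y, hy⟩ := ih (defect φ m x) (by rw [d_defect, hx, map_zero])
      (defect_mem_weight φ m hw).1
    have h1 : retr φ m (retr φ m x) = retr φ m x := retr_of_mem_small φ m (retr_mem_small φ m x)
    -- The induction hypothesis leaves the retraction of the error. Since `r² = r` and `r` commutes
    -- with `∂`, it equals `-∂ r(h x)`, which gives the last term.
    refine ⟨homot φ m x + y - retr φ m (homot φ m x), ?_⟩
    rw [map_sub, map_add, hy, ← retr_d, defect_apply, hx, map_zero, add_zero, map_sub, map_sub, h1]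
    abel

end InternalAlg

theorem isQuasiIso_retraction (φ : CoeffMap K n k) (m : Fin n → ℤ) :
    (retraction φ m).IsQuasiIso := by
  refine DGAlgebra.Hom.isQuasiIso_of_cocycles _ (fun x hx y hy => ?_) (fun i y hy hdy => ?_)
  · obtain ⟨z, hz⟩ := InternalAlg.exists_d_eq_sub_retr φ m x hx
    have hy' : InternalAlg.d φ m y.1 = InternalAlg.retr φ m x := congrArg Subtype.val hy
    -- If `r x = ∂t` then `x = (x - r x) + r x` is the boundary of `z + t`.
    have h : ∀ t : InternalAlg φ, InternalAlg.d φ m t = InternalAlg.retr φ m x →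
        InternalAlg.d φ m (z + t) = x := fun t ht => by
      rw [map_add, hz, ht]
      exact sub_add_cancel (G := InternalAlg φ) _ _
    exact ⟨_, h y.1 hy'⟩
  · exact ⟨y.1, hy, congrArg Subtype.val hdy,
      Subtype.ext (InternalAlg.retr_of_mem_small φ m y.2)⟩

end Retraction

/-! ## The case `n = 2` -/

section Laurent

variable {K : Type u} [Field K] {V : Type w} [AddCommGroup V] [Module K V]

/-- The linear map on Laurent polynomials with given values on the monomials. -/
def laurentLift (f : ℤ → V) : LaurentPolynomial K →ₗ[K] V :=
  Finsupp.linearCombination K f ∘ₗ (AddMonoidAlgebra.coeffLinearEquiv K).toLinearMap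

theorem laurentLift_T (f : ℤ → V) (a : ℤ) :
    laurentLift f (LaurentPolynomial.T a : LaurentPolynomial K) = f a := by
  have h : laurentLift f (LaurentPolynomial.T a : LaurentPolynomial K) =
      Finsupp.linearCombination K f (Finsupp.single a 1) := rfl
  rw [h, Finsupp.linearCombination_single, one_smul]

theorem laurentLift_apply (f : ℤ → V) (x : LaurentPolynomial K) :
    laurentLift f x = ∑ a ∈ x.coeff.support, x.coeff a • f a := rfl

theorem laurent_ext {f g : LaurentPolynomial K →ₗ[K] V}
    (h : ∀ a, f (LaurentPolynomial.T a) = g (LaurentPolynomial.T a)) : f = g :=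
  AddMonoidAlgebra.lhom_ext' fun a => LinearMap.ext_ring (h a)

theorem T_mem_gradeBy (e a : ℤ) : (LaurentPolynomial.T a : LaurentPolynomial K) ∈
    AddMonoidAlgebra.gradeBy K (AddMonoidHom.mulRight e) (a * e) :=
  AddMonoidAlgebra.single_mem_gradeBy (AddMonoidHom.mulRight e) a 1

end Laurent

namespace InternalAlg

open LaurentPolynomial (T)

section Two

variable {K : Type u} [Field K] (m : Fin 2 → ℤ)

/-- The generator `c^p_{ij}` of `I_2^K`. -/
abbrev c₂ (K : Type u) [Field K] (p : ℕ) (i j : Fin 2) : InternalAlg (CoeffMap.collapse K 2) :=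
  c (CoeffMap.collapse K 2) p i j

/-- The source and target relations become vacuous, so only `c^0_{ij} = 0` for `j ≤ i` has to be
checked when mapping out of this algebra. -/
theorem collapse_idem (n : ℕ) (i : Fin n) : (CoeffMap.collapse K n).idem i = 1 := by
  simp [CoeffMap.idem, CoeffMap.collapse, LinearMap.sum_apply, Pi.single_apply]

theorem e_collapse (n : ℕ) (i : Fin n) : e (CoeffMap.collapse K n) i = 1 := by
  rw [e, collapse_idem, map_one]

/-- The sign `(-1) ^ (m_0 + m_1)`. -/
def relParity : ℤ := parity m 0 * parity m 1

theorem relParity_mul_self : relParity m * relParity m = 1 := by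
  rw [relParity]
  linear_combination (parity m 1 * parity m 1) * parity_mul_self m 0 + parity_mul_self m 1

/-! ### The morphism to Laurent polynomials and its section -/

/-- The image of `c^p_{ij}` in the Laurent polynomials. -/
def laurentGen (K : Type u) [Field K] (p : ℕ) (i j : Fin 2) : LaurentPolynomial K :=
  if p = 0 ∧ i = 0 ∧ j = 1 then T 1
  else if p = 1 ∧ i = 1 ∧ j = 0 then -(relParity m • T (-1)) else 0

theorem laurentGen_eq_zero {p : ℕ} {i j : Fin 2} (h1 : ¬(p = 0 ∧ i = 0 ∧ j = 1))
    (h2 : ¬(p = 1 ∧ i = 1 ∧ j = 0)) : laurentGen m K p i j = 0 := by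
  rw [laurentGen, if_neg h1, if_neg h2]

/-- The morphism from `I_2^K` to the Laurent polynomials, as an algebra map. -/
def toLaurent : InternalAlg (CoeffMap.collapse K 2) →ₐ[K] LaurentPolynomial K :=
  lift (CoeffMap.collapse K 2) (Algebra.ofId K _) (laurentGen m K)
    (fun p i j => by rw [collapse_idem, map_one, one_mul])
    (fun p i j => by rw [collapse_idem, map_one, mul_one])
    (fun i j h => laurentGen_eq_zero m (fun h' => by simp [h'.2.1, h'.2.2] at h) (by simp))

theorem toLaurent_base (a : K) :
    toLaurent m (base (CoeffMap.collapse K 2) a) = algebraMap K _ a := lift_base ..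

theorem toLaurent_c (p : ℕ) (i j : Fin 2) : toLaurent m (c₂ K p i j) = laurentGen m K p i j :=
  lift_c ..

theorem toLaurent_mem {s : ℤ} {x : InternalAlg (CoeffMap.collapse K 2)}
    (hx : x ∈ grading (CoeffMap.collapse K 2) m s) :
    toLaurent m x ∈ AddMonoidAlgebra.gradeBy K (AddMonoidHom.mulRight (1 + m 1 - m 0)) s := by
  induction hx using Submodule.span_induction with
  | mem x hx =>
    induction hx with
    | base a =>
      rw [toLaurent_base, Algebra.algebraMap_eq_smul_one, ← LaurentPolynomial.T_zero]
      convert Submodule.smul_mem _ a (T_mem_gradeBy (1 + m 1 - m 0) 0) using 1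
      rw [zero_mul]
    | gen p i j =>
      rw [toLaurent_c, laurentGen]
      split_ifs with h1 h2
      · obtain ⟨rfl, rfl, rfl⟩ := h1
        convert T_mem_gradeBy (1 + m 1 - m 0) 1 using 2
        rw [deg]
        push_cast
        ring
      · obtain ⟨rfl, rfl, rfl⟩ := h2
        refine neg_mem (zsmul_mem ?_ _)
        convert T_mem_gradeBy (1 + m 1 - m 0) (-1) using 2
        rw [deg]
        push_cast
        ring
      · exact zero_mem _
    | mul _ _ h1 h2 =>
      rw [map_mul]
      exact (AddMonoidAlgebra.gradeBy.gradedMonoid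
        (AddMonoidHom.mulRight (1 + m 1 - m 0))).mul_mem h1 h2
  | zero => rw [map_zero]; exact zero_mem _
  | add x y _ _ h1 h2 => rw [map_add]; exact add_mem h1 h2
  | smul t x _ h => rw [map_smul]; exact Submodule.smul_mem _ t h

/-- Only `c^1_{00}` and `c^1_{11}` need a computation: there the idempotent term `1` meets `ε` times
a product of `z` and `-ε z⁻¹`, which forces the coefficient chosen for `c^1_{10}`. -/
theorem toLaurent_d (x : InternalAlg (CoeffMap.collapse K 2)) :
    toLaurent m (d (CoeffMap.collapse K 2) m x) = 0 := by
  induction x using induction with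
  | hb a => rw [d_base, map_zero]
  | hc p i j =>
    -- Two factors with nonzero image and common vertex `r` must be `c^0_{01}` and `c^1_{10}` in
    -- some order, so the upper indices add up to `1`.
    have hprod : ∀ (q : ℕ × ℕ) (r : Fin 2), q ∈ Finset.HasAntidiagonal.antidiagonal p → p ≠ 1 →
        laurentGen m K q.1 r j * laurentGen m K q.2 i r = 0 := by
      intro q r hq hp
      have hq := Finset.HasAntidiagonal.mem_antidiagonal.1 hq
      rw [laurentGen, laurentGen]
      split_ifs with h1 h2 h3 h4 h5 h6 <;> first
        | exact mul_zero _
        | exact zero_mul _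
        | omega
    rw [d_c, dGen, map_add, map_sum]
    simp only [map_sum, Units.smul_def, map_zsmul, map_mul, toLaurent_c]
    by_cases hp : p = 1
    · subst hp
      rw [Finset.Nat.antidiagonal_succ]
      have hT : (T (-1) : LaurentPolynomial K) * T 1 = 1 := by
        rw [← LaurentPolynomial.T_add]; simp
      have hT' : (T 1 : LaurentPolynomial K) * T (-1) = 1 := by
        rw [← LaurentPolynomial.T_add]; simp
      have hs : ((m 0 + m 1).negOnePow : ℤ) = relParity m := by
        rw [Int.negOnePow_add, Units.val_mul]
        rfl
      have hs' : ((m 1 + m 0).negOnePow : ℤ) = relParity m := by rw [add_comm, hs]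
      have h2 : relParity m • ((relParity m : ℤ) : LaurentPolynomial K) = 1 := by
        rw [zsmul_eq_mul, ← Int.cast_mul, relParity_mul_self, Int.cast_one]
      fin_cases i <;> fin_cases j <;>
        simp [laurentGen, e_collapse, hT, hT', hs, hs', h2, -zsmul_eq_mul]
    · rw [if_neg (fun h => hp h.1), map_zero, zero_add]
      exact Finset.sum_eq_zero fun q hq => Finset.sum_eq_zero fun r _ => by
        rw [hprod q r hq hp, smul_zero]
  | hadd x y hx hy => rw [map_add, map_add, hx, hy, add_zero]
  | hmul x y hx hy =>
    rw [d_mul_sgn, map_add, map_mul, map_mul, hx, hy, zero_mul, mul_zero, add_zero]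

/-- The representative `-(-1) ^ (m_0 + m_1) c^1_{10}` of `z⁻¹`. -/
def negGen (K : Type u) [Field K] : InternalAlg (CoeffMap.collapse K 2) :=
  -(relParity m • c₂ K 1 1 0)

/-- The section of `toLaurent` on monomials. -/
def laurentSectionMonomial (K : Type u) [Field K] : ℤ → InternalAlg (CoeffMap.collapse K 2)
  | .ofNat a => c₂ K 0 0 1 ^ a
  | .negSucc a => negGen m K ^ (a + 1)

/-- A linear section of `toLaurent`. -/
def laurentSection : LaurentPolynomial K →ₗ[K] InternalAlg (CoeffMap.collapse K 2) :=
  laurentLift (laurentSectionMonomial m K)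

theorem laurentSection_T (a : ℕ) : laurentSection m (T a) = c₂ K 0 0 1 ^ a := by
  rw [laurentSection, laurentLift_T]
  rfl

theorem laurentSection_T_neg (a : ℕ) : laurentSection m (T (-a)) = negGen m K ^ a := by
  rw [laurentSection, laurentLift_T]
  rcases a with _ | a
  · rw [Nat.cast_zero, neg_zero, pow_zero]
    exact pow_zero _
  · rfl

theorem d_c₂_zero : d (CoeffMap.collapse K 2) m (c₂ K 0 0 1) = 0 := by
  rw [d_c, dGen]
  simp [c_zero]

/-- Every quadratic term contains `c^0_{r0}` or `c^0_{1r}`, which vanish as they do not increase the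
index. -/
theorem d_negGen : d (CoeffMap.collapse K 2) m (negGen m K) = 0 := by
  rw [negGen, map_neg, map_zsmul, d_c, dGen, Finset.Nat.antidiagonal_succ]
  simp [c_zero]

theorem d_laurentSection (x : LaurentPolynomial K) :
    d (CoeffMap.collapse K 2) m (laurentSection m x) = 0 := by
  rw [laurentSection, laurentLift_apply, map_sum]
  refine Finset.sum_eq_zero fun a _ => ?_
  rw [map_smul]
  rcases a with a | a
  · exact (congrArg _ (d_pow_eq_zero _ m (d_c₂_zero m) a)).trans (smul_zero _)
  · exact (congrArg _ (d_pow_eq_zero _ m (d_negGen m) (a + 1))).trans (smul_zero _)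

theorem toLaurent_laurentSection (x : LaurentPolynomial K) :
    toLaurent m (laurentSection m x) = x := by
  suffices h : (toLaurent m).toLinearMap ∘ₗ laurentSection m = LinearMap.id (R := K) from
    LinearMap.congr_fun h x
  refine laurent_ext fun a => ?_
  change toLaurent m (laurentSection m (T a)) = T a
  obtain ⟨a, rfl | rfl⟩ := a.eq_nat_or_neg
  · rw [laurentSection_T, map_pow, toLaurent_c, laurentGen, if_pos ⟨rfl, rfl, rfl⟩,
      LaurentPolynomial.T_pow, mul_one]
  · rw [laurentSection_T_neg, map_pow, negGen, map_neg, map_zsmul, toLaurent_c, laurentGen,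
      if_neg (by simp), if_pos ⟨rfl, rfl, rfl⟩, smul_neg, neg_neg, smul_smul, relParity_mul_self,
      one_smul, LaurentPolynomial.T_pow, mul_neg, mul_one]

theorem laurentSection_mem {s : ℤ} {x : LaurentPolynomial K}
    (hx : x ∈ AddMonoidAlgebra.gradeBy K (AddMonoidHom.mulRight (1 + m 1 - m 0)) s) :
    laurentSection m x ∈ grading (CoeffMap.collapse K 2) m s := by
  have hpow : ∀ {t : ℤ} {y : InternalAlg (CoeffMap.collapse K 2)},
      y ∈ grading (CoeffMap.collapse K 2) m t → ∀ a : ℕ,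
      y ^ a ∈ grading (CoeffMap.collapse K 2) m (a * t) := by
    intro t y hy a
    rw [← nsmul_eq_mul]
    exact SetLike.pow_mem_graded a hy
  rw [laurentSection, laurentLift_apply]
  refine sum_mem fun a ha => Submodule.smul_mem _ _ ?_
  have hs : a * (1 + m 1 - m 0) = s := hx a ha
  rw [← hs]
  rcases a with a | a
  · have h := hpow (c_mem (CoeffMap.collapse K 2) m 0 0 1) a
    have hd : deg m 0 0 1 = 1 + m 1 - m 0 := by
      rw [deg]
      push_cast
      omega
    rwa [hd] at h
  · have h := hpow (neg_mem (zsmul_mem (c_mem (CoeffMap.collapse K 2) m 1 1 0) (relParity m)))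
      (a + 1)
    -- The class of `z⁻¹` sits in degree `-1 + m_0 - m_1 = -(1 + m_1 - m_0)`.
    have hd : ((a + 1 : ℕ) : ℤ) * deg m 1 1 0 = Int.negSucc a * (1 + m 1 - m 0) := by
      rw [deg, Int.negSucc_eq]
      push_cast
      ring
    rwa [hd] at h

/-! ### The merging homotopy -/

/-- The word obtained from `c^p_{ij}` times the normal word of `z ^ a` by merging the rightmost
letter of the generator with the adjacent power of `z` or `z⁻¹`, with a sign. -/
def mergeMonomial (K : Type u) [Field K] (p : ℕ) (i j : Fin 2) :
    ℤ → InternalAlg (CoeffMap.collapse K 2)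
  | .ofNat 0 => 0
  -- The product `c^p_{1j} c^0_{01}` is a summand of `∂c^p_{0j}`. The case `p = 0` is excluded
  -- because `c^0_{1j} = 0` while `c^0_{01}` is not a relation.
  | .ofNat (a + 1) => if p ≠ 0 ∧ i = 1 then
      (parity m 1 * parity m j) • (c₂ K p 0 j * c₂ K 0 0 1 ^ a) else 0
  -- The product `c^p_{0j} c^1_{10}` is a summand of `∂c^{p+1}_{1j}`. The excluded pair is `c^0_{00}
  -- = 0`, for which `c^1_{10}` would be the value.
  | .negSucc a => if ¬(p = 0 ∧ j = 0) ∧ i = 0 then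
      -((parity m 1 * parity m j) • (c₂ K (p + 1) 1 j * negGen m K ^ a)) else 0

/-- The linear extension of `mergeMonomial`. -/
def mergeGen (K : Type u) [Field K] (p : ℕ) (i j : Fin 2) :
    LaurentPolynomial K →ₗ[K] InternalAlg (CoeffMap.collapse K 2) :=
  laurentLift (mergeMonomial m K p i j)

theorem mergeGen_zero_T (p : ℕ) (j : Fin 2) (a : ℕ) : mergeGen m K p 0 j (T a) = 0 := by
  rw [mergeGen, laurentLift_T]
  cases a
  · rfl
  · exact if_neg (by simp)

theorem mergeGen_one_T_neg (p : ℕ) (j : Fin 2) (a : ℕ) : mergeGen m K p 1 j (T (-a)) = 0 := by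
  rw [mergeGen, laurentLift_T]
  rcases a with _ | a
  · rw [Nat.cast_zero, neg_zero]
    rfl
  · exact if_neg (by simp)

theorem mergeGen_one_T (p : ℕ) (j : Fin 2) (a : ℕ) :
    mergeGen m K p 1 j (T (a + 1 : ℕ)) = if p = 0 then 0 else
      (parity m 1 * parity m j) • (c₂ K p 0 j * c₂ K 0 0 1 ^ a) := by
  rw [mergeGen, laurentLift_T]
  have h : mergeMonomial m K p 1 j (a + 1 : ℕ) = if p ≠ 0 ∧ (1 : Fin 2) = 1 then
      (parity m 1 * parity m j) • (c₂ K p 0 j * c₂ K 0 0 1 ^ a) else 0 := rfl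
  rw [h]
  by_cases hp : p = 0 <;> simp [hp]

theorem mergeGen_zero_T_neg (p : ℕ) (j : Fin 2) (a : ℕ) :
    mergeGen m K p 0 j (T (-(a + 1 : ℕ))) = if p = 0 ∧ j = 0 then 0 else
      -((parity m 1 * parity m j) • (c₂ K (p + 1) 1 j * negGen m K ^ a)) := by
  rw [mergeGen, laurentLift_T]
  have h : mergeMonomial m K p 0 j (-(a + 1 : ℕ)) = if ¬(p = 0 ∧ j = 0) ∧ (0 : Fin 2) = 0 then
      -((parity m 1 * parity m j) • (c₂ K (p + 1) 1 j * negGen m K ^ a)) else 0 := rfl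
  rw [h]
  by_cases hp : p = 0 ∧ j = 0
  · rw [if_pos hp, if_neg (fun h => h.1 hp)]
  · rw [if_neg hp, if_pos ⟨hp, rfl⟩]

theorem mergeGen_eq_zero (i j : Fin 2) (h : j ≤ i) : mergeGen m K 0 i j = 0 := by
  refine laurent_ext fun a => ?_
  rw [LinearMap.zero_apply]
  obtain ⟨a, rfl | rfl⟩ := a.eq_nat_or_neg
  · fin_cases i
    · exact mergeGen_zero_T m 0 j a
    · rcases a with _ | a
      · rw [mergeGen, laurentLift_T]
        rfl
      · exact (mergeGen_one_T m 0 j a).trans (if_pos rfl)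
  · fin_cases i
    · have hj : j = 0 := le_antisymm h (Fin.zero_le j)
      rcases a with _ | a
      · rw [mergeGen, laurentLift_T]
        simp [mergeMonomial]
      · exact (mergeGen_zero_T_neg m 0 j a).trans (if_pos ⟨rfl, hj⟩)
    · exact mergeGen_one_T_neg m 0 j a

/-- The action of a triple `(g, s, η)` on pairs: `(ρ, x) ↦ (g ρ, s x + η ρ)`. -/
def pairAction {R A : Type u} [CommRing R] [Algebra K R] [Ring A] [Algebra K A] (g : R) (s : A)
    (η : R →ₗ[K] A) : Module.End K (R × A) :=
  LinearMap.prod (LinearMap.mulLeft K g ∘ₗ LinearMap.fst K R A)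
    (LinearMap.mulLeft K s ∘ₗ LinearMap.snd K R A + η ∘ₗ LinearMap.fst K R A)

/-- The representation of `I_2^K` on pairs whose off-diagonal part is the merging operator. -/
def mergeRep : InternalAlg (CoeffMap.collapse K 2) →ₐ[K]
    Module.End K (LaurentPolynomial K × InternalAlg (CoeffMap.collapse K 2)) :=
  lift (CoeffMap.collapse K 2) (Algebra.ofId K _)
    (fun p i j => pairAction (laurentGen m K p i j)
      (sgn (CoeffMap.collapse K 2) m (c₂ K p i j)) (mergeGen m K p i j))
    (fun p i j => by rw [collapse_idem, map_one, one_mul])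
    (fun p i j => by rw [collapse_idem, map_one, mul_one])
    (fun i j h => by
      have hc : c₂ K 0 i j = 0 := c_zero _ i j h
      rw [mergeGen_eq_zero m i j h, ← toLaurent_c, hc, map_zero, map_zero]
      ext x <;> simp [pairAction])

/-- The merging operator `I_2^K ⊗ K[z, z⁻¹] → I_2^K`. -/
def merge : InternalAlg (CoeffMap.collapse K 2) →ₗ[K] LaurentPolynomial K →ₗ[K]
    InternalAlg (CoeffMap.collapse K 2) where
  toFun v := LinearMap.snd K _ _ ∘ₗ mergeRep m v ∘ₗ LinearMap.inl K _ _
  map_add' v w := by rw [map_add]; rfl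
  map_smul' t v := by rw [map_smul]; rfl

theorem mergeRep_apply (v : InternalAlg (CoeffMap.collapse K 2)) (ρ : LaurentPolynomial K)
    (x : InternalAlg (CoeffMap.collapse K 2)) :
    mergeRep m v (ρ, x) =
      (toLaurent m v * ρ, sgn (CoeffMap.collapse K 2) m v * x + merge m v ρ) := by
  have h : ∀ (v : InternalAlg (CoeffMap.collapse K 2)) ρ,
      merge m v ρ = (mergeRep m v (ρ, 0)).2 := fun _ _ => rfl
  induction v using induction generalizing ρ x with
  | hb a =>
    have h1 : mergeRep m (base (CoeffMap.collapse K 2) a) = algebraMap K _ a := lift_base ..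
    rw [h, h1, toLaurent_base, sgn_base]
    have h2 : base (CoeffMap.collapse K 2) a = algebraMap K _ a :=
      AlgHom.commutes (base (CoeffMap.collapse K 2)) a
    rw [h2, ← Algebra.smul_def, ← Algebra.smul_def]
    simp [Module.algebraMap_end_apply]
  | hc p i j =>
    have h1 : mergeRep m (c₂ K p i j) = pairAction (laurentGen m K p i j)
      (sgn (CoeffMap.collapse K 2) m (c₂ K p i j)) (mergeGen m K p i j) := lift_c ..
    rw [h, h1, toLaurent_c]
    simp [pairAction]
  | hadd v w hv hw =>
    rw [map_add, LinearMap.add_apply, hv, hw, map_add, map_add, map_add, LinearMap.add_apply,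
      Prod.mk_add_mk, add_mul, add_mul]
    congr 1
    abel
  | hmul v w hv hw =>
    rw [h, map_mul, Module.End.mul_apply, Module.End.mul_apply, hw, hv, hw ρ 0, hv,
      map_mul (toLaurent m), map_mul (sgn _ m), mul_zero, zero_add, mul_add, mul_assoc, mul_assoc,
      add_assoc]

/-- This is the off-diagonal entry of a product of triangular operators: merging is a derivation
into linear maps from Laurent polynomials to `I_2`, acted on by the grading sign from the left and
by `toLaurent` from the right. -/
theorem merge_mul (v w : InternalAlg (CoeffMap.collapse K 2)) (ρ : LaurentPolynomial K) :
    merge m (v * w) ρ =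
      sgn (CoeffMap.collapse K 2) m v * merge m w ρ + merge m v (toLaurent m w * ρ) := by
  change (mergeRep m (v * w) (ρ, 0)).2 = _
  rw [map_mul, Module.End.mul_apply, mergeRep_apply, mergeRep_apply, mul_zero, zero_add]

theorem merge_base (a : K) : merge m (base (CoeffMap.collapse K 2) a) = 0 := by
  refine LinearMap.ext fun ρ => ?_
  have h1 : mergeRep m (base (CoeffMap.collapse K 2) a) = algebraMap K _ a := lift_base ..
  change (mergeRep m (base (CoeffMap.collapse K 2) a) (ρ, 0)).2 = 0
  rw [h1, Module.algebraMap_end_apply, Prod.smul_snd, smul_zero]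

theorem merge_c (p : ℕ) (i j : Fin 2) : merge m (c₂ K p i j) = mergeGen m K p i j := by
  refine LinearMap.ext fun ρ => ?_
  have h1 : mergeRep m (c₂ K p i j) = pairAction (laurentGen m K p i j)
    (sgn (CoeffMap.collapse K 2) m (c₂ K p i j)) (mergeGen m K p i j) := lift_c ..
  change (mergeRep m (c₂ K p i j) (ρ, 0)).2 = _
  rw [h1]
  simp [pairAction]

theorem sgn_c₂ (p : ℕ) (i j : Fin 2) : sgn (CoeffMap.collapse K 2) m (c₂ K p i j) =
    -((parity m i * parity m j) • c₂ K p i j) := by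
  have h : (deg m p i j).negOnePow = -(m i + m j).negOnePow := by
    rw [← Int.negOnePow_succ, Int.negOnePow_eq_iff, deg]
    exact ⟨-p - m i, by ring⟩
  rw [sgn_c, h, Units.neg_smul, negOnePow_add_smul, smul_smul]

theorem parity_four (a b c : Fin 2) :
    parity m a * parity m b * (parity m a * parity m c) = parity m b * parity m c := by
  linear_combination (parity m b * parity m c) * parity_mul_self m a

/-- The grading sign of the left factor cancels the structural sign `(-1)^{m_r+m_j}` in the first
family of terms, leaving a uniform minus. -/
theorem merge_dGen (p : ℕ) (i j : Fin 2) (ρ : LaurentPolynomial K) :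
    merge m (dGen (CoeffMap.collapse K 2) m p i j) ρ =
      ∑ q ∈ Finset.HasAntidiagonal.antidiagonal p, ∑ r : Fin 2,
        (-(c₂ K q.1 r j * mergeGen m K q.2 i r ρ) + (parity m r * parity m j) •
          mergeGen m K q.1 r j (laurentGen m K q.2 i r * ρ)) := by
  have h0 : merge m (if p = 1 ∧ i = j then e (CoeffMap.collapse K 2) i else 0) = 0 := by
    split_ifs
    · exact merge_base m _
    · exact map_zero _
  rw [dGen, map_add, h0, zero_add, map_sum, LinearMap.sum_apply]
  refine Finset.sum_congr rfl fun q _ => ?_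
  rw [map_sum, LinearMap.sum_apply]
  refine Finset.sum_congr rfl fun r _ => ?_
  rw [negOnePow_add_smul, smul_smul, map_zsmul, LinearMap.smul_apply, merge_mul, merge_c, merge_c,
    toLaurent_c, sgn_c₂, smul_add, neg_mul, smul_mul_assoc, smul_neg, smul_smul, parity_four,
    parity_mul_self, one_smul]

/-! ### The homotopy identity on generators and monomials -/

theorem mergeGen_laurentGen_zero (q q' : ℕ) (r j : Fin 2) (a : ℕ) :
    mergeGen m K q' r j (laurentGen m K q 0 r * T a) =
      if q = 0 ∧ r = 1 then mergeGen m K q' 1 j (T (a + 1 : ℕ)) else 0 := by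
  split_ifs with h
  · obtain ⟨rfl, rfl⟩ := h
    rw [laurentGen, if_pos ⟨rfl, rfl, rfl⟩, ← LaurentPolynomial.T_add]
    congr 2
    push_cast
    ring
  · rw [laurentGen_eq_zero m (fun h' => h ⟨h'.1, h'.2.2⟩) (by simp), zero_mul, map_zero]

theorem mergeGen_laurentGen_zero_neg (q q' : ℕ) (r j : Fin 2) (a : ℕ) :
    mergeGen m K q' r j (laurentGen m K q 0 r * T (-(a + 1 : ℕ))) = 0 := by
  by_cases h : q = 0 ∧ r = 1
  · obtain ⟨rfl, rfl⟩ := h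
    rw [laurentGen, if_pos ⟨rfl, rfl, rfl⟩, ← LaurentPolynomial.T_add]
    have ha : (1 + -(a + 1 : ℕ) : ℤ) = -a := by push_cast; ring
    rw [ha, mergeGen_one_T_neg]
  · rw [laurentGen_eq_zero m (fun h' => h ⟨h'.1, h'.2.2⟩) (by simp), zero_mul, map_zero]

theorem mergeGen_laurentGen_one_neg (q q' : ℕ) (r j : Fin 2) (a : ℕ) :
    mergeGen m K q' r j (laurentGen m K q 1 r * T (-a)) =
      if q = 1 ∧ r = 0 then -(relParity m • mergeGen m K q' 0 j (T (-(a + 1 : ℕ)))) else 0 := by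
  split_ifs with h
  · obtain ⟨rfl, rfl⟩ := h
    rw [laurentGen, if_neg (by simp), if_pos ⟨rfl, rfl, rfl⟩, neg_mul, smul_mul_assoc,
      ← LaurentPolynomial.T_add, map_neg, map_zsmul]
    congr 4
    push_cast
    ring
  · rw [laurentGen_eq_zero m (by simp) (fun h' => h ⟨h'.1, h'.2.2⟩), zero_mul, map_zero]

theorem mergeGen_laurentGen_one (q q' : ℕ) (r j : Fin 2) (a : ℕ) :
    mergeGen m K q' r j (laurentGen m K q 1 r * T (a + 1 : ℕ)) = 0 := by
  by_cases h : q = 1 ∧ r = 0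
  · obtain ⟨rfl, rfl⟩ := h
    rw [laurentGen, if_neg (by simp), if_pos ⟨rfl, rfl, rfl⟩, neg_mul, smul_mul_assoc,
      ← LaurentPolynomial.T_add]
    have ha : (-1 + (a + 1 : ℕ) : ℤ) = a := by push_cast; ring
    rw [ha, map_neg, map_zsmul, mergeGen_zero_T, smul_zero, neg_zero]
  · rw [laurentGen_eq_zero m (by simp) (fun h' => h ⟨h'.1, h'.2.2⟩), zero_mul, map_zero]

theorem laurentSection_laurentGen_one (p : ℕ) (j : Fin 2) (a : ℕ) :
    laurentSection m (laurentGen m K p 1 j * T (a + 1 : ℕ)) =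
      if p = 1 ∧ j = 0 then -(relParity m • c₂ K 0 0 1 ^ a) else 0 := by
  split_ifs with h
  · have ha : (-1 + (a + 1 : ℕ) : ℤ) = a := by push_cast; ring
    rw [laurentGen, if_neg (by simp), if_pos ⟨h.1, rfl, h.2⟩, neg_mul, smul_mul_assoc,
      ← LaurentPolynomial.T_add, ha, map_neg, map_zsmul, laurentSection_T]
  · rw [laurentGen_eq_zero m (by simp) (fun h' => h ⟨h'.1, h'.2.2⟩), zero_mul, map_zero]

theorem laurentSection_laurentGen_one_neg (p : ℕ) (j : Fin 2) (a : ℕ) :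
    laurentSection m (laurentGen m K p 1 j * T (-a)) =
      if p = 1 ∧ j = 0 then c₂ K 1 1 0 * negGen m K ^ a else 0 := by
  split_ifs with h
  · have ha : (-1 + -a : ℤ) = -(a + 1 : ℕ) := by push_cast; ring
    rw [laurentGen, if_neg (by simp), if_pos ⟨h.1, rfl, h.2⟩, neg_mul, smul_mul_assoc,
      ← LaurentPolynomial.T_add, ha, map_neg, map_zsmul, laurentSection_T_neg, pow_succ', negGen,
      neg_mul, smul_neg, neg_neg, smul_mul_assoc, smul_smul, relParity_mul_self, one_smul]
  · rw [laurentGen_eq_zero m (by simp) (fun h' => h ⟨h'.1, h'.2.2⟩), zero_mul, map_zero]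

theorem laurentSection_laurentGen_zero (p : ℕ) (j : Fin 2) (a : ℕ) :
    laurentSection m (laurentGen m K p 0 j * T a) =
      if p = 0 ∧ j = 1 then c₂ K 0 0 1 ^ (a + 1) else 0 := by
  split_ifs with h
  · have ha : (1 + a : ℤ) = (a + 1 : ℕ) := by push_cast; ring
    rw [laurentGen, if_pos ⟨h.1, rfl, h.2⟩, ← LaurentPolynomial.T_add, ha, laurentSection_T]
  · rw [laurentGen_eq_zero m (fun h' => h ⟨h'.1, h'.2.2⟩) (by simp), zero_mul, map_zero]

theorem laurentSection_laurentGen_zero_neg (p : ℕ) (j : Fin 2) (a : ℕ) :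
    laurentSection m (laurentGen m K p 0 j * T (-(a + 1 : ℕ))) =
      if p = 0 ∧ j = 1 then negGen m K ^ a else 0 := by
  split_ifs with h
  · have ha : (1 + -(a + 1 : ℕ) : ℤ) = -a := by push_cast; ring
    rw [laurentGen, if_pos ⟨h.1, rfl, h.2⟩, ← LaurentPolynomial.T_add, ha, laurentSection_T_neg]
  · rw [laurentGen_eq_zero m (fun h' => h ⟨h'.1, h'.2.2⟩) (by simp), zero_mul, map_zero]

theorem smul_dGen_mul (p : ℕ) (i j : Fin 2) (x : InternalAlg (CoeffMap.collapse K 2)) :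
    (parity m 1 * parity m j) • (dGen (CoeffMap.collapse K 2) m p i j * x) =
      (if p = 1 ∧ i = j then (parity m 1 * parity m j) • x else 0) +
      ∑ q ∈ Finset.HasAntidiagonal.antidiagonal p, ∑ r : Fin 2,
        (parity m 1 * parity m r) • (c₂ K q.1 r j * c₂ K q.2 i r * x) := by
  rw [dGen, add_mul, smul_add]
  congr 1
  · rw [e_collapse]
    split_ifs
    · rw [one_mul]
    · rw [zero_mul, smul_zero]
  · rw [Finset.sum_mul, Finset.smul_sum]
    refine Finset.sum_congr rfl fun q _ => ?_
    rw [Finset.sum_mul, Finset.smul_sum]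
    refine Finset.sum_congr rfl fun r _ => ?_
    rw [negOnePow_add_smul, smul_mul_assoc, smul_mul_assoc, smul_smul, smul_smul]
    congr 1
    linear_combination (parity m 1 * parity m r) * parity_mul_self m j

/-- For `p ≥ 1` the homotopy is `± c^p_{0j} z^a`, with `z` standing for `c^0_{01}`. In its boundary
the summand through `c^0_{01}` is the desired product, the idempotent term (for `p = 1`, `j = 0`) is
the section term, and the rest cancels against the merged differential. -/
theorem merge_identity_one_T (p : ℕ) (j : Fin 2) (a : ℕ) :
    c₂ K p 1 j * laurentSection m (T (a + 1 : ℕ)) -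
        laurentSection m (laurentGen m K p 1 j * T (a + 1 : ℕ)) =
      d (CoeffMap.collapse K 2) m (mergeGen m K p 1 j (T (a + 1 : ℕ))) +
        merge m (dGen (CoeffMap.collapse K 2) m p 1 j) (T (a + 1 : ℕ)) := by
  rw [laurentSection_laurentGen_one, laurentSection_T]
  rcases Nat.eq_zero_or_pos p with rfl | hp
  · have hj : j ≤ 1 := by omega
    have hc : c₂ K 0 1 j = 0 := c_zero _ 1 j hj
    rw [hc, mergeGen_eq_zero m 1 j hj, dGen_zero _ _ _ _ hj, if_neg (by simp)]
    simp
  · have hsplit : ∀ (q : ℕ × ℕ) (r : Fin 2),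
        -(c₂ K q.1 r j * mergeGen m K q.2 1 r (T (a + 1 : ℕ))) + (parity m r * parity m j) •
          mergeGen m K q.1 r j (laurentGen m K q.2 1 r * T (a + 1 : ℕ)) =
        (if q.2 = 0 ∧ r = 1 then c₂ K q.1 1 j * c₂ K 0 0 1 ^ (a + 1) else 0) -
        (parity m 1 * parity m r) • (c₂ K q.1 r j * c₂ K q.2 0 r * c₂ K 0 0 1 ^ a) := by
      intro q r
      rw [mergeGen_laurentGen_one, smul_zero, add_zero, mergeGen_one_T]
      by_cases hq : q.2 = 0
      · rw [if_pos hq, mul_zero, neg_zero, hq]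
        by_cases hr : r = 1
        · rw [hr, if_pos ⟨rfl, rfl⟩, parity_mul_self, one_smul, pow_succ', mul_assoc, sub_self]
        · have hr0 : r = 0 := by omega
          have hc : c₂ K 0 0 0 = 0 := c_zero _ 0 0 le_rfl
          rw [if_neg (fun h => hr h.2), hr0, hc, mul_zero, zero_mul, smul_zero, sub_zero]
      · rw [if_neg hq, if_neg (fun h => hq h.1), zero_sub, mul_smul_comm, mul_assoc]
    have hsum : ∑ q ∈ Finset.HasAntidiagonal.antidiagonal p, ∑ r : Fin 2,
        (if q.2 = 0 ∧ r = 1 then c₂ K q.1 1 j * c₂ K 0 0 1 ^ (a + 1) else 0) =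
        c₂ K p 1 j * c₂ K 0 0 1 ^ (a + 1) := by
      rw [Finset.sum_eq_single (p, 0)]
      · simp
      · intro q hq hne
        have hq := Finset.HasAntidiagonal.mem_antidiagonal.1 hq
        have h2 : q.2 ≠ 0 := fun h => hne (Prod.ext (by omega) h)
        simp [h2]
      · simp
    rw [merge_dGen, mergeGen_one_T, if_neg hp.ne', map_zsmul,
      d_mul_of_d_eq_zero _ _ _ (d_pow_eq_zero _ m (d_c₂_zero m) a), d_c, smul_dGen_mul]
    simp only [hsplit, Finset.sum_sub_distrib]
    rw [hsum]
    by_cases h : p = 1 ∧ j = 0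
    · rw [if_pos h, if_pos ⟨h.1, h.2.symm⟩, h.2, relParity, mul_comm (parity m 0)]
      abel
    · rw [if_neg h, if_neg (fun h' => h ⟨h'.1, h'.2.symm⟩)]
      abel

/-- Here merging the generator itself gives nothing. The left side is recovered from the one summand
`c^p_{1j} c^0_{01}` of the differential, whose second letter raises the power to `z^{a+1}` before
the first is merged back to `c^p_{0j}`. -/
theorem merge_identity_zero_T (p : ℕ) (j : Fin 2) (a : ℕ) :
    c₂ K p 0 j * laurentSection m (T a) - laurentSection m (laurentGen m K p 0 j * T a) =
      d (CoeffMap.collapse K 2) m (mergeGen m K p 0 j (T a)) +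
        merge m (dGen (CoeffMap.collapse K 2) m p 0 j) (T a) := by
  have hsum : ∑ q ∈ Finset.HasAntidiagonal.antidiagonal p, ∑ r : Fin 2,
      (parity m r * parity m j) •
        (if q.2 = 0 ∧ r = 1 then mergeGen m K q.1 1 j (T (a + 1 : ℕ)) else 0) =
      (parity m 1 * parity m j) • mergeGen m K p 1 j (T (a + 1 : ℕ)) := by
    rw [Finset.sum_eq_single (p, 0)]
    · simp
    · intro q hq hne
      have hq := Finset.HasAntidiagonal.mem_antidiagonal.1 hq
      have h2 : q.2 ≠ 0 := fun h => hne (Prod.ext (by omega) h)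
      simp [h2]
    · simp
  rw [laurentSection_laurentGen_zero, laurentSection_T, mergeGen_zero_T, map_zero, zero_add,
    merge_dGen]
  simp only [mergeGen_laurentGen_zero, mergeGen_zero_T, mul_zero, neg_zero, zero_add]
  rw [hsum, mergeGen_one_T]
  by_cases hp : p = 0
  · rw [if_pos hp, smul_zero, hp]
    by_cases hj : j = 1
    · rw [if_pos ⟨rfl, hj⟩, hj, pow_succ', sub_self]
    · have hj0 : j = 0 := by omega
      have hc : c₂ K 0 0 0 = 0 := c_zero _ 0 0 le_rfl
      rw [if_neg (fun h => hj h.2), hj0, hc, zero_mul, sub_zero]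
  · rw [if_neg hp, if_neg (fun h => hp h.1), smul_smul, parity_four, parity_mul_self, one_smul,
      sub_zero]

/-- The surviving summand of the differential is `c^{p-1}_{0j} c^1_{10}`, merged back to `c^p_{1j}`.
For `c^1_{10}` that summand is absent, but then the section is multiplicative on this product. -/
theorem merge_identity_one_T_neg (p : ℕ) (j : Fin 2) (a : ℕ) :
    c₂ K p 1 j * laurentSection m (T (-a)) - laurentSection m (laurentGen m K p 1 j * T (-a)) =
      d (CoeffMap.collapse K 2) m (mergeGen m K p 1 j (T (-a))) +
        merge m (dGen (CoeffMap.collapse K 2) m p 1 j) (T (-a)) := by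
  rw [laurentSection_laurentGen_one_neg, laurentSection_T_neg, mergeGen_one_T_neg, map_zero,
    zero_add, merge_dGen]
  simp only [mergeGen_laurentGen_one_neg, mergeGen_one_T_neg, mul_zero, neg_zero, zero_add]
  rcases p with _ | p
  · have hc : c₂ K 0 1 j = 0 := c_zero _ 1 j (by omega)
    rw [hc]
    simp
  · have hsum : ∑ q ∈ Finset.HasAntidiagonal.antidiagonal (p + 1), ∑ r : Fin 2,
        (parity m r * parity m j) • (if q.2 = 1 ∧ r = 0 then
          -(relParity m • mergeGen m K q.1 0 j (T (-(a + 1 : ℕ)))) else 0) =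
        (parity m 0 * parity m j) • -(relParity m • mergeGen m K p 0 j (T (-(a + 1 : ℕ)))) := by
      rw [Finset.sum_eq_single (p, 1)]
      · simp
      · intro q hq hne
        have hq := Finset.HasAntidiagonal.mem_antidiagonal.1 hq
        have h2 : q.2 ≠ 1 := fun h => hne (Prod.ext (by omega) h)
        simp [h2]
      · simp
    rw [hsum, mergeGen_zero_T_neg]
    by_cases h : p = 0 ∧ j = 0
    · rw [if_pos h, if_pos ⟨by omega, h.2⟩, h.1, h.2, smul_zero, neg_zero, smul_zero, zero_add,
        sub_self]
    · rw [if_neg h, if_neg (fun h' => h ⟨by omega, h'.2⟩), smul_neg, smul_neg, smul_neg,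
        neg_neg, smul_smul, smul_smul, relParity, sub_zero]
      have hs : parity m 0 * parity m j * (parity m 0 * parity m 1 * (parity m 1 * parity m j)) =
          1 := by
        linear_combination (parity m 0 * parity m 0 * parity m 1 * parity m 1) *
          parity_mul_self m j + (parity m 0 * parity m 0) * parity_mul_self m 1 +
          parity_mul_self m 0
      rw [mul_assoc, hs, one_smul]

/-- Now the homotopy is `± c^{p+1}_{1j} y^a`. Its boundary contains the desired product through
`c^1_{10}`, and its idempotent term (for `p = 0`, `j = 1`) is the section term. -/
theorem merge_identity_zero_T_neg (p : ℕ) (j : Fin 2) (a : ℕ) :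
    c₂ K p 0 j * laurentSection m (T (-(a + 1 : ℕ))) -
        laurentSection m (laurentGen m K p 0 j * T (-(a + 1 : ℕ))) =
      d (CoeffMap.collapse K 2) m (mergeGen m K p 0 j (T (-(a + 1 : ℕ)))) +
        merge m (dGen (CoeffMap.collapse K 2) m p 0 j) (T (-(a + 1 : ℕ))) := by
  rw [laurentSection_laurentGen_zero_neg, laurentSection_T_neg]
  by_cases hpj : p = 0 ∧ j = 0
  · obtain ⟨rfl, rfl⟩ := hpj
    have hc : c₂ K 0 0 0 = 0 := c_zero _ 0 0 le_rfl
    rw [hc, mergeGen_eq_zero m 0 0 le_rfl, dGen_zero _ _ _ _ le_rfl, if_neg (by simp)]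
    simp
  · have hsplit : ∀ (q : ℕ × ℕ) (r : Fin 2),
        -(c₂ K q.1 r j * mergeGen m K q.2 0 r (T (-(a + 1 : ℕ)))) + (parity m r * parity m j) •
          mergeGen m K q.1 r j (laurentGen m K q.2 0 r * T (-(a + 1 : ℕ))) =
        (if q.2 = 0 ∧ r = 0 then c₂ K q.1 0 j * negGen m K ^ (a + 1) else 0) +
        (parity m 1 * parity m r) • (c₂ K q.1 r j * c₂ K (q.2 + 1) 1 r * negGen m K ^ a) := by
      intro q r
      rw [mergeGen_laurentGen_zero_neg, smul_zero, add_zero, mergeGen_zero_T_neg]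
      by_cases hq : q.2 = 0 ∧ r = 0
      · rw [if_pos hq, if_pos hq, mul_zero, neg_zero, hq.1, hq.2, pow_succ', negGen, relParity,
          mul_comm (parity m 0), neg_mul, mul_neg, smul_mul_assoc, mul_smul_comm, mul_assoc,
          neg_add_cancel]
      · rw [if_neg hq, if_neg hq, zero_add, mul_neg, neg_neg, mul_smul_comm, mul_assoc]
    have hsum : ∑ q ∈ Finset.HasAntidiagonal.antidiagonal p, ∑ r : Fin 2,
        (if q.2 = 0 ∧ r = 0 then c₂ K q.1 0 j * negGen m K ^ (a + 1) else 0) =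
        c₂ K p 0 j * negGen m K ^ (a + 1) := by
      rw [Finset.sum_eq_single (p, 0)]
      · simp
      · intro q hq hne
        have hq := Finset.HasAntidiagonal.mem_antidiagonal.1 hq
        have h2 : q.2 ≠ 0 := fun h => hne (Prod.ext (by omega) h)
        simp [h2]
      · simp
    -- This removes the summand of `∂c^{p+1}_{1j}` whose right letter has upper index `0`; the
    -- others are indexed by the splittings of `p`, as in the merged differential.
    have hzero : ∀ r : Fin 2, c₂ K 0 1 r = 0 := fun r => c_zero _ 1 r (by omega)
    rw [merge_dGen, mergeGen_zero_T_neg, if_neg hpj, map_neg, map_zsmul,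
      d_mul_of_d_eq_zero _ _ _ (d_pow_eq_zero _ m (d_negGen m) a), d_c, smul_dGen_mul,
      Finset.Nat.antidiagonal_succ', Finset.sum_cons, Finset.sum_map]
    simp only [hsplit, Finset.sum_add_distrib, hzero, mul_zero, zero_mul, smul_zero,
      Finset.sum_const_zero, zero_add, Function.Embedding.prodMap, Function.Embedding.coeFn_mk,
      Prod.map, Function.Embedding.refl_apply, Nat.succ_eq_add_one]
    rw [hsum]
    by_cases h : p = 0 ∧ j = 1
    · rw [if_pos h, if_pos ⟨by omega, h.2.symm⟩, h.2, parity_mul_self, one_smul]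
      abel
    · rw [if_neg h, if_neg (fun h' => h ⟨by omega, h'.2.symm⟩)]
      abel

/-- Both sides satisfy the same twisted product rule in `v`, so the four monomial computations on
generators suffice. -/
theorem merge_identity (v : InternalAlg (CoeffMap.collapse K 2)) (ρ : LaurentPolynomial K) :
    v * laurentSection m ρ - laurentSection m (toLaurent m v * ρ) =
      d (CoeffMap.collapse K 2) m (merge m v ρ) + merge m (d (CoeffMap.collapse K 2) m v) ρ := by
  induction v using induction generalizing ρ with
  | hb a =>
    have h2 : base (CoeffMap.collapse K 2) a = algebraMap K _ a :=
      AlgHom.commutes (base (CoeffMap.collapse K 2)) a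
    rw [merge_base, d_base, map_zero, LinearMap.zero_apply, map_zero, add_zero, toLaurent_base, h2,
      ← Algebra.smul_def, ← Algebra.smul_def, map_smul, sub_self]
  | hc p i j =>
    suffices h : LinearMap.mulLeft K (c₂ K p i j) ∘ₗ laurentSection m -
        laurentSection m ∘ₗ LinearMap.mulLeft K (laurentGen m K p i j) =
        d (CoeffMap.collapse K 2) m ∘ₗ mergeGen m K p i j +
          merge m (dGen (CoeffMap.collapse K 2) m p i j) by
      rw [toLaurent_c, merge_c, d_c]
      exact LinearMap.congr_fun h ρ
    refine laurent_ext fun a => ?_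
    obtain ⟨a, rfl | rfl⟩ := a.eq_nat_or_neg
    · fin_cases i
      · exact merge_identity_zero_T m p j a
      · rcases a with _ | a
        · have h := merge_identity_one_T_neg (K := K) m p j 0
          rw [Nat.cast_zero, neg_zero] at h
          exact h
        · exact merge_identity_one_T m p j a
    · fin_cases i
      · rcases a with _ | a
        · rw [Nat.cast_zero, neg_zero]
          exact merge_identity_zero_T m p j 0
        · exact merge_identity_zero_T_neg m p j a
      · exact merge_identity_one_T_neg m p j a
  | hadd v w hv hw =>
    simp only [map_add, add_mul, LinearMap.add_apply]
    rw [add_sub_add_comm, hv, hw]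
    abel
  | hmul v w hv hw =>
    have hv' := hv (toLaurent m w * ρ)
    have hw' := hw ρ
    -- Telescoping through `v s(π(w) ρ)`: first `w` is moved across the section, then `v`.
    have h1 : v * w * laurentSection m ρ - laurentSection m (toLaurent m (v * w) * ρ) =
        v * (w * laurentSection m ρ - laurentSection m (toLaurent m w * ρ)) +
        (v * laurentSection m (toLaurent m w * ρ) -
          laurentSection m (toLaurent m v * (toLaurent m w * ρ))) := by
      rw [map_mul (toLaurent m), mul_assoc (toLaurent m v)]
      noncomm_ring
    rw [h1, hv', hw', merge_mul, d_mul_sgn, map_add, map_add, LinearMap.add_apply, merge_mul,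
      merge_mul, d_mul_sgn, toLaurent_d, zero_mul, map_zero, sgn_sgn, sgn_d]
    noncomm_ring

end Two

end InternalAlg

/-- The morphism `I_2^K → K[z, z⁻¹]`. -/
def laurentHom {K : Type u} [Field K] (m : Fin 2 → ℤ) :
    (internalDG (CoeffMap.collapse K 2) m).Hom (DGAlgebra.laurent K (1 + m 1 - m 0)) where
  toAlgHom := InternalAlg.toLaurent m
  map_mem _ _ hx := InternalAlg.toLaurent_mem m hx
  comm x := InternalAlg.toLaurent_d m x

theorem laurentHom_c {K : Type u} [Field K] (m : Fin 2 → ℤ) :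
    laurentHom m (InternalAlg.c (CoeffMap.collapse K 2) 0 0 1) = LaurentPolynomial.T 1 :=
  (InternalAlg.toLaurent_c m 0 0 1).trans (if_pos ⟨rfl, rfl, rfl⟩)

theorem isQuasiIso_laurentHom {K : Type u} [Field K] (m : Fin 2 → ℤ) :
    (laurentHom (K := K) m).IsQuasiIso := by
  refine DGAlgebra.Hom.isQuasiIso_of_cocycles _ (fun x hx y hy => ?_) (fun i y hy _ => ?_)
  · have hx' : InternalAlg.d (CoeffMap.collapse K 2) m x = 0 := hx
    have hy' : InternalAlg.toLaurent m x = 0 := hy.symm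
    -- Since `s(1) = 1`, merging `x` with the empty word gives a primitive of `x`.
    have h := InternalAlg.merge_identity m x 1
    have h1 : InternalAlg.laurentSection m 1 = (1 : InternalAlg (CoeffMap.collapse K 2)) := by
      have h := InternalAlg.laurentSection_T (K := K) m 0
      rwa [Nat.cast_zero, LaurentPolynomial.T_zero, pow_zero] at h
    rw [hx', hy', zero_mul, map_zero, map_zero, LinearMap.zero_apply, add_zero, h1, sub_zero] at h
    exact ⟨_, h.symm.trans (mul_one (M := InternalAlg (CoeffMap.collapse K 2)) x)⟩
  · exact ⟨InternalAlg.laurentSection m y, InternalAlg.laurentSection_mem m hy,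
      InternalAlg.d_laurentSection m y, InternalAlg.toLaurent_laurentSection m y⟩

end

theorem mainTheorem6 {K : Type u} [Field K] :
    (∀ (n : ℕ) (m : Fin n → ℤ) (k : Type v) [Ring k] [Algebra K k] (φ : CoeffMap K n k),
      ∃ r : (internalDG φ m).Hom (smallDG φ m), IsRetraction φ m r ∧ r.IsQuasiIso) ∧
    (∀ m : Fin 2 → ℤ,
      ∃ g : (internalDG (CoeffMap.collapse K 2) m).Hom (DGAlgebra.laurent K (1 + m 1 - m 0)),
        g (InternalAlg.c (CoeffMap.collapse K 2) 0 0 1) = LaurentPolynomial.T 1 ∧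
        g.IsQuasiIso) :=
  ⟨fun _ m _ _ _ φ => ⟨retraction φ m, isRetraction_retraction φ m, isQuasiIso_retraction φ m⟩,
    fun m => ⟨laurentHom m, laurentHom_c m, isQuasiIso_laurentHom m⟩⟩
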